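/- **Setting.** Let $d\in\{2,3\}$, let $\Omega\subset\mathbb R^d$ be a bounded domain (open and connected), $1<p\le 2$, $1/p+1/p^*=1$, $f\in L^\infty(\Omega)$, and let $j:H^1_0(\Omega)\to L^1(\Omega)$ be Fréchet differentiable with derivative $v\mapsto j'(u)\,v$, where $j'(u)\in L^2(\Omega)$ for all $u\in H_0^1(\Omega)$. Let $u_\Omega,y_\Omega\in H^1_0(\Omega)$ be the solutions of $$(\nabla u_\Omega,\nabla v)=(f,v),\qquad (\nabla y_\Omega,\nabla v)=-(j'(u_\Omega),v)\qquad\text{for all }v\in H_0^1(\Omega),$$ where $(\cdot,\cdot)$ denotes the integral over $\Omega$ of the (Euclidean or Frobenius) product, and put $$K=(\nabla u_\Omega\cdot\nabla y_\Omega)\,I-\nabla y_\Omega\otimes\nabla u_\Omega-\nabla u_\Omega\otimes\nabla y_\Omega,\qquad F(\chi)=(f\,\nabla y_\Omega,\chi)+(j(u_\Omega),\operatorname{div}\chi).$$ Let $\Sigma^{p,0}$ be the set of $T\in L^p(\Omega;\mathbb R^{d\times d})$ whose row-wise distributional divergence lies in $L^p(\Omega;\mathbb R^d)$ and whose normal trace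 vanishes, i.e. $(T,\nabla\chi)+(\operatorname{div}T,\chi)=0$ for all $\chi\in W^{1,p^*}(\Omega;\mathbb R^d)$. For general $T\in L^p(\Omega;\mathbb R^{d\times d})$, "$\operatorname{div}T=F$ with zero normal trace" is understood in the weak sense: call $T$ *admissible* if $$-(T,\nabla\chi)=F(\chi)\qquad\text{for all }\chi\in W^{1,p^*}(\Omega;\mathbb R^d),$$ where for $T\in\Sigma^{p,0}$ the left-hand side equals $(\operatorname{div}T,\chi)$. Let $$\eta_p(\Omega)=\inf\{\|T-K\|_{L^p(\Omega)}:T\text{ admissible}\}.$$ **Assumptions.** The Helmholtz decomposition $L^{p^*}(\Omega;\mathbb R^d)=G_{p^*}(\Omega)\oplus H_{p^*}(\Omega)$ holds, where $G_{p^*}(\Omega)=\{\nabla\vartheta:\vartheta\in W^{1,p^*}(\Omega)\}$ and $H_{p^*}(\Omega)$ is the space of divergence-free fields with zero normal trace, i.e. of those $h\in L^{p^*}(\Omega;\mathbb R^d)$ with $(h,\nabla\chi)=0$ for all $\chi\in W^{1,p}(\Omega)$. Moreover $K\in L^p(\Omega;\mathbb R^{d\times d})$, $j(u_\Omega)\in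 L^2(\Omega)$, and $(f\,\nabla y_\Omega,e)=0$ for all constant $e\in\mathbb R^d$. **Theorem.** The KKT system: $S$ is admissible and $$\bigl(|S-K|^{p-2}(S-K),T\bigr)+(\operatorname{div}T,\theta)=0\qquad\text{for all }T\in\Sigma^{p,0}$$ (with $|S-K|^{p-2}(S-K):=0$ where $S=K$) has a solution $(S,\theta)\in L^p(\Omega;\mathbb R^{d\times d})\times W^{1,p^*}(\Omega;\mathbb R^d)$. Here $S$ is the unique minimizer of $\eta_p(\Omega)$, i.e. the unique admissible field with $\|S-K\|_{L^p(\Omega)}=\eta_p(\Omega)$; and $\theta$ is unique up to additive constant vectors: the solutions of the KKT system are exactly the pairs $(S,\theta+e)$ with $e\in\mathbb R^d$. If moreover $j(u_\Omega)\in W^{1,p}_0(\Omega)$, then the admissible fields are exactly the $T\in\Sigma^{p,0}$ with $(\operatorname{div}T,\chi)=F(\chi)$ for all $\chi\in W^{1,p^*}(\Omega;\mathbb R^d)$; in particular $S\in\Sigma^{p,0}$. -/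

import Mathlib

open MeasureTheory
open scoped ENNReal

noncomputable section

namespace ShapeLp

/-- Column vectors in `ℝ^d`, with the Euclidean norm. -/
abbrev Vec (d : ℕ) : Type := EuclideanSpace ℝ (Fin d)

/-- Real `d × d` matrices with the Frobenius norm and inner product;
`A i` is the `i`-th row and `A i k` the entry in row `i` and column `k`. -/
abbrev Mat (d : ℕ) : Type := PiLp 2 (fun _ : Fin d => Vec d)

/-- Test functions: smooth with compact support in `Ω`. -/
def IsTest {d : ℕ} (Ω : Set (Vec d)) (φ : Vec d → ℝ) : Prop :=
  ContDiff ℝ (⊤ : ℕ∞) φ ∧ HasCompactSupport φ ∧ tsupport φ ⊆ Ω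

/-- `u ∈ W^{1,q}(Ω)` with weak gradient `g`. -/
def MemW1 {d : ℕ} (Ω : Set (Vec d)) (q : ℝ≥0∞) (u : Vec d → ℝ) (g : Vec d → Vec d) : Prop :=
  MemLp u q (volume.restrict Ω) ∧ MemLp g q (volume.restrict Ω) ∧
    ∀ φ : Vec d → ℝ, IsTest Ω φ → ∀ i : Fin d,
      ∫ x in Ω, u x * gradient φ x i = - ∫ x in Ω, g x i * φ x

/-- `θ ∈ W^{1,q}(Ω; ℝ^d)` with weak Jacobian `Dθ`, whose rows are the weak gradients of the
components of `θ`. -/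
def MemW1Vec {d : ℕ} (Ω : Set (Vec d)) (q : ℝ≥0∞) (θ : Vec d → Vec d) (Dθ : Vec d → Mat d) :
    Prop :=
  ∀ i : Fin d, MemW1 Ω q (fun x => θ x i) (fun x => Dθ x i)

/-- `u ∈ W_0^{1,q}(Ω)` with weak gradient `g`: `u` lies in the closure of the test functions in
the norm of `W^{1,q}(Ω)`. For `q = 2` this is `H_0^1(Ω)`. -/
def MemW10 {d : ℕ} (Ω : Set (Vec d)) (q : ℝ≥0∞) (u : Vec d → ℝ) (g : Vec d → Vec d) : Prop :=
  MemW1 Ω q u g ∧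
    ∀ ε : ℝ, 0 < ε → ∃ φ : Vec d → ℝ, IsTest Ω φ ∧
      eLpNorm (fun x => u x - φ x) q (volume.restrict Ω) ≤ ENNReal.ofReal ε ∧
      eLpNorm (fun x => g x - gradient φ x) q (volume.restrict Ω) ≤ ENNReal.ofReal ε

/-- A norm of `W^{1,2}(Ω)`, evaluated at a function `v` with weak gradient `gv`. -/
def h1Norm {d : ℕ} (Ω : Set (Vec d)) (v : Vec d → ℝ) (gv : Vec d → Vec d) : ℝ≥0∞ :=
  eLpNorm v 2 (volume.restrict Ω) + eLpNorm gv 2 (volume.restrict Ω)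

/-- `j : H_0^1(Ω) → L^1(Ω)` is Fréchet differentiable, its derivative at `u` is the
multiplication `v ↦ j'(u) v` with a function `j'(u) = dj u`, and `j'(u) ∈ L^2(Ω)`
for all `u ∈ H_0^1(Ω)`. -/
structure IsDiffIntegrand {d : ℕ} (Ω : Set (Vec d)) (j dj : (Vec d → ℝ) → (Vec d → ℝ)) :
    Prop where
  integrable : ∀ u gu, MemW10 Ω 2 u gu → IntegrableOn (j u) Ω
  memLp_deriv : ∀ u gu, MemW10 Ω 2 u gu → MemLp (dj u) 2 (volume.restrict Ω)
  differentiable : ∀ u gu, MemW10 Ω 2 u gu → ∀ ε : ℝ, 0 < ε → ∃ δ : ℝ, 0 < δ ∧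
    ∀ v gv, MemW10 Ω 2 v gv → h1Norm Ω v gv ≤ ENNReal.ofReal δ →
      eLpNorm (fun x => j (u + v) x - j u x - dj u x * v x) 1 (volume.restrict Ω)
        ≤ ENNReal.ofReal ε * h1Norm Ω v gv

/-- `u` (with weak gradient `gu`) is the weak solution in `H_0^1(Ω)` of the Dirichlet problem
`(∇u, ∇v) = (r, v)` for all `v ∈ H_0^1(Ω)`. -/
def IsDirichletSolution {d : ℕ} (Ω : Set (Vec d)) (r : Vec d → ℝ)
    (u : Vec d → ℝ) (gu : Vec d → Vec d) : Prop :=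
  MemW10 Ω 2 u gu ∧
    ∀ v gv, MemW10 Ω 2 v gv → ∫ x in Ω, inner ℝ (gu x) (gv x) = ∫ x in Ω, r x * v x

/-- The Sturm-Laurain shape tensor `(∇u · ∇y) I - ∇y ⊗ ∇u - ∇u ⊗ ∇y`, written row by row in terms
of `gu = ∇u` and `gy = ∇y`. -/
def shapeTensor {d : ℕ} (gu gy : Vec d → Vec d) (x : Vec d) : Mat d :=
  WithLp.toLp 2 (fun i : Fin d =>
    inner ℝ (gu x) (gy x) • EuclideanSpace.single i (1 : ℝ)
      - gy x i • gu x - gu x i • gy x)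

/-- The functional `F(χ) = (f ∇y, χ) + (j(u), div χ)`, where `gy = ∇y`, `ju = j(u)`, and
`Dχ` is the weak Jacobian of `χ`, so that `div χ` is its trace. -/
def constraintFunctional {d : ℕ} (Ω : Set (Vec d)) (f : Vec d → ℝ) (gy : Vec d → Vec d)
    (ju : Vec d → ℝ) (χ : Vec d → Vec d) (Dχ : Vec d → Mat d) : ℝ :=
  (∫ x in Ω, f x * inner ℝ (gy x) (χ x)) + ∫ x in Ω, ju x * ∑ i : Fin d, Dχ x i i

/-- `T ∈ Σ^p`, with row-wise distributional divergence `divT`: both are in `L^p(Ω)`. -/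
def MemSigma {d : ℕ} (Ω : Set (Vec d)) (p : ℝ) (T : Vec d → Mat d) (divT : Vec d → Vec d) :
    Prop :=
  MemLp T (ENNReal.ofReal p) (volume.restrict Ω) ∧
  MemLp divT (ENNReal.ofReal p) (volume.restrict Ω) ∧
    ∀ φ : Vec d → ℝ, IsTest Ω φ → ∀ i : Fin d,
      ∫ x in Ω, inner ℝ (T x i) (gradient φ x) = - ∫ x in Ω, divT x i * φ x

/-- The duality pairing `⟨T · n, χ⟩` on the boundary of `Ω`, given by Green's formula. -/
def normalTrace {d : ℕ} (Ω : Set (Vec d)) (T : Vec d → Mat d) (divT : Vec d → Vec d)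
    (χ : Vec d → Vec d) (Dχ : Vec d → Mat d) : ℝ :=
  (∫ x in Ω, inner ℝ (T x) (Dχ x)) + ∫ x in Ω, inner ℝ (divT x) (χ x)

/-- `T ∈ Σ^{p,0}` with divergence `divT`: `T ∈ Σ^p` and `⟨T · n, χ⟩ = 0` for all
`χ ∈ W^{1,p*}(Ω; ℝ^d)`; `ps` is the dual exponent `p*`. -/
def MemSigmaZero {d : ℕ} (Ω : Set (Vec d)) (p ps : ℝ) (T : Vec d → Mat d)
    (divT : Vec d → Vec d) : Prop :=
  MemSigma Ω p T divT ∧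
    ∀ χ Dχ, MemW1Vec Ω (ENNReal.ofReal ps) χ Dχ → normalTrace Ω T divT χ Dχ = 0

/-- `(div T, χ)` for a field `T` in `L^p(Ω)` of vanishing normal trace, with the divergence
taken as a functional on `W^{1,p*}(Ω; ℝ^d)`: it is `-(T, ∇χ)`. For `T ∈ Σ^{p,0}` this is
`∫ div T · χ`. -/
def weakDiv {d : ℕ} (Ω : Set (Vec d)) (T : Vec d → Mat d) (Dχ : Vec d → Mat d) : ℝ :=
  - ∫ x in Ω, inner ℝ (T x) (Dχ x)

/-- For `T ∈ Σ^{p,0}` the functional `weakDiv` is the integral against `div T`. -/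
theorem MemSigmaZero.weakDiv_eq {d : ℕ} {Ω : Set (Vec d)} {p ps : ℝ} {T : Vec d → Mat d}
    {divT : Vec d → Vec d} (hT : MemSigmaZero Ω p ps T divT) {χ : Vec d → Vec d}
    {Dχ : Vec d → Mat d} (hχ : MemW1Vec Ω (ENNReal.ofReal ps) χ Dχ) :
    weakDiv Ω T Dχ = ∫ x in Ω, inner ℝ (divT x) (χ x) := by
  have h := hT.2 χ Dχ hχ
  unfold normalTrace at h
  unfold weakDiv
  linarith

/-- The admissible fields: `T ∈ L^p(Ω; ℝ^{d×d})` with `div T = F` and `T · n = 0`, both in the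
weak sense, that is `-(T, ∇χ) = F(χ)` for all `χ ∈ W^{1,p*}(Ω; ℝ^d)`. -/
def IsAdmissible {d : ℕ} (Ω : Set (Vec d)) (p ps : ℝ) (f : Vec d → ℝ) (gy : Vec d → Vec d)
    (ju : Vec d → ℝ) (T : Vec d → Mat d) : Prop :=
  MemLp T (ENNReal.ofReal p) (volume.restrict Ω) ∧
    ∀ χ Dχ, MemW1Vec Ω (ENNReal.ofReal ps) χ Dχ →
      weakDiv Ω T Dχ = constraintFunctional Ω f gy ju χ Dχ

/-- The fields `T ∈ Σ^{p,0}`, with `div T ∈ L^p(Ω; ℝ^d)`, such that `(div T, χ) = F(χ)` for all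
`χ ∈ W^{1,p*}(Ω; ℝ^d)`. -/
def IsStrictlyAdmissible {d : ℕ} (Ω : Set (Vec d)) (p ps : ℝ) (f : Vec d → ℝ)
    (gy : Vec d → Vec d) (ju : Vec d → ℝ) (T : Vec d → Mat d) : Prop :=
  ∃ divT, MemSigmaZero Ω p ps T divT ∧
    ∀ χ Dχ, MemW1Vec Ω (ENNReal.ofReal ps) χ Dχ →
      ∫ x in Ω, inner ℝ (divT x) (χ x) = constraintFunctional Ω f gy ju χ Dχ

/-- The `L^p` distance `η_p` of the tensor `K` to the admissible fields. -/
def eta {d : ℕ} (Ω : Set (Vec d)) (p ps : ℝ) (f : Vec d → ℝ) (gy : Vec d → Vec d)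
    (ju : Vec d → ℝ) (K : Vec d → Mat d) : ℝ≥0∞ :=
  sInf {r | ∃ T, IsAdmissible Ω p ps f gy ju T ∧
    r = eLpNorm (fun x => T x - K x) (ENNReal.ofReal p) (volume.restrict Ω)}

/-- `T` is admissible and attains the infimum `η_p`. -/
def IsMinimizer {d : ℕ} (Ω : Set (Vec d)) (p ps : ℝ) (f : Vec d → ℝ) (gy : Vec d → Vec d)
    (ju : Vec d → ℝ) (K : Vec d → Mat d) (T : Vec d → Mat d) : Prop :=
  IsAdmissible Ω p ps f gy ju T ∧
    eLpNorm (fun x => T x - K x) (ENNReal.ofReal p) (volume.restrict Ω) =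
      eta Ω p ps f gy ju K

/-- The KKT system: `S` is admissible, `θ ∈ W^{1,p*}(Ω; ℝ^d)`, and
`(|S - K|^{p-2} (S - K), T) + (div T, θ) = 0` for all `T ∈ Σ^{p,0}`
(the integrand of the first term is `0` where `S = K`). -/
def IsKKT {d : ℕ} (Ω : Set (Vec d)) (p ps : ℝ) (f : Vec d → ℝ) (gy : Vec d → Vec d)
    (ju : Vec d → ℝ) (K : Vec d → Mat d) (S : Vec d → Mat d) (θ : Vec d → Vec d) : Prop :=
  IsAdmissible Ω p ps f gy ju S ∧
  (∃ Dθ, MemW1Vec Ω (ENNReal.ofReal ps) θ Dθ) ∧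
    ∀ T divT, MemSigmaZero Ω p ps T divT →
      (∫ x in Ω, inner ℝ (‖S x - K x‖ ^ (p - 2) • (S x - K x)) (T x))
        + ∫ x in Ω, inner ℝ (divT x) (θ x) = 0

/-- `h ∈ H_q(Ω)`: `h ∈ L^q(Ω; ℝ^d)` is divergence-free with vanishing normal trace, that is,
orthogonal to `∇χ` for all `χ ∈ W^{1,q*}(Ω)` (hence for all test functions). -/
def IsSolenoidal {d : ℕ} (Ω : Set (Vec d)) (q qs : ℝ) (h : Vec d → Vec d) : Prop :=
  MemLp h (ENNReal.ofReal q) (volume.restrict Ω) ∧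
    ∀ χ gχ, MemW1 Ω (ENNReal.ofReal qs) χ gχ → ∫ x in Ω, inner ℝ (h x) (gχ x) = 0

/-- The Helmholtz decomposition `L^q(Ω; ℝ^d) = G_q(Ω) ⊕ H_q(Ω)` as a direct sum, where `G_q(Ω)`
consists of the gradients of the functions in `W^{1,q}(Ω)`; `qs` is the dual exponent of `q`. -/
def HasHelmholtz {d : ℕ} (Ω : Set (Vec d)) (q qs : ℝ) : Prop :=
  (∀ v : Vec d → Vec d, MemLp v (ENNReal.ofReal q) (volume.restrict Ω) →
    ∃ ϑ g h, MemW1 Ω (ENNReal.ofReal q) ϑ g ∧ IsSolenoidal Ω q qs h ∧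
      v =ᵐ[volume.restrict Ω] g + h) ∧
  ∀ ϑ g, MemW1 Ω (ENNReal.ofReal q) ϑ g → IsSolenoidal Ω q qs g →
    g =ᵐ[volume.restrict Ω] 0

end ShapeLp

end

noncomputable section

namespace ShapeLp

/-! ### The duality map of `L^r` -/

section DualityMap

/-! Tested with matrix fields that have one non-zero entry `φ`, the second KKT equation says exactly
that the weak Jacobian of `θ` is `|S - K|^{p-2} (S - K)`; conversely this identity gives the
equation for every `T ∈ Σ^{p,0}`, by the vanishing normal trace (`isKKT_iff`). The duality maps for
`p` and `p*` are mutually inverse, so `S = K + |∇θ|^{p*-2} ∇θ`, and admissibility of `S` becomes a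
`p*`-Laplace equation for `θ` alone: `(|∇θ|^{p*-2} ∇θ, ∇χ) + (K, ∇χ) + F(χ) = 0` for all `χ`.

This is the Euler-Lagrange equation of `‖∇θ‖^{p*} / p* + (K, ∇θ) + F(θ)`, minimized over fields of
mean zero. Since `p ≤ 2` gives `p* ≥ 2`, Clarkson's inequality makes minimizing sequences Cauchy, so
no weak compactness is needed. Coercivity is the Poincaré inequality. It needs no boundary
regularity: the Helmholtz decomposition exhibits `L^{p*}` as a direct sum of Banach spaces, one of
them the mean-zero Sobolev space embedded by its gradient, and the open mapping theorem bounds the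
inverse (`exists_poincare`). The compatibility condition on `f ∇y` removes the mean-zero restriction
on test fields.

Uniqueness rests on strict convexity. The difference of two admissible fields is orthogonal to all
Jacobians, in particular to `|S - K|^{p-2} (S - K)`, and the strict tangent inequality for `|·|^p`
then makes `S` the only minimizer. Two multipliers have the same weak Jacobian, hence differ by a
constant on the connected set `Ω`, as mollification shows.

If `j(u) ∈ W_0^{1,p}`, Green's formula turns `F(χ)` into `(f ∇y - ∇j(u), χ)`, which identifies the
divergence of every admissible field as an `L^p` function. -/

theorem norm_rpow_sub_two_mul {E : Type*} [NormedAddCommGroup E] {r : ℝ} (hr : 1 < r) (a : E) :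
    ‖a‖ ^ (r - 2) * ‖a‖ = ‖a‖ ^ (r - 1) := by
  rcases eq_or_ne a 0 with rfl | ha
  · rw [norm_zero, mul_zero, Real.zero_rpow (by linarith)]
  · rw [← Real.rpow_add_one (norm_ne_zero_iff.2 ha)]
    ring_nf

theorem norm_rpow_sub_one_mul {E : Type*} [NormedAddCommGroup E] {r : ℝ} (hr : 1 < r) (a : E) :
    ‖a‖ ^ (r - 1) * ‖a‖ = ‖a‖ ^ r := by
  rcases eq_or_ne a 0 with rfl | ha
  · rw [norm_zero, mul_zero, Real.zero_rpow (by linarith)]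
  · rw [← Real.rpow_add_one (norm_ne_zero_iff.2 ha)]
    ring_nf

variable {E : Type*} [NormedAddCommGroup E] [InnerProductSpace ℝ E]

/-- The duality map `a ↦ |a|^{r-2} a`. -/
def dualityMap (r : ℝ) (a : E) : E := ‖a‖ ^ (r - 2) • a

theorem norm_dualityMap {r : ℝ} (hr : 1 < r) (a : E) : ‖dualityMap r a‖ = ‖a‖ ^ (r - 1) := by
  rw [dualityMap, norm_smul, Real.norm_of_nonneg (by positivity), norm_rpow_sub_two_mul hr]

theorem inner_dualityMap_self {r : ℝ} (hr : 1 < r) (a : E) :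
    inner ℝ (dualityMap r a) a = ‖a‖ ^ r := by
  rw [dualityMap, inner_smul_left, real_inner_self_eq_norm_sq, conj_trivial, sq, ← mul_assoc,
    norm_rpow_sub_two_mul hr, norm_rpow_sub_one_mul hr]

/-- The powers of `‖a‖` cancel because `r s = r + s`. This is what recovers `S` from the multiplier.
-/
theorem dualityMap_dualityMap {r s : ℝ} (h : r.HolderConjugate s) (a : E) :
    dualityMap s (dualityMap r a) = a := by
  rcases eq_or_ne a 0 with rfl | ha
  · simp [dualityMap]
  have ha' : 0 < ‖a‖ := norm_pos_iff.2 ha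
  have hm : (r - 1) * (s - 2) + (r - 2) = 0 := by
    have := h.mul_eq_add
    linarith
  rw [dualityMap, norm_dualityMap h.lt, dualityMap, smul_smul, ← Real.rpow_mul ha'.le,
    ← Real.rpow_add ha', hm, Real.rpow_zero, one_smul]

theorem continuous_dualityMap {r : ℝ} (hr : 1 < r) : Continuous (dualityMap r : E → E) := by
  rw [continuous_iff_continuousAt]
  intro a
  rcases eq_or_ne a 0 with rfl | ha
  -- For `r < 2` the scalar factor is unbounded near the origin, so continuity there is read off
  -- from the norm `‖a‖ ^ (r - 1)`.
  · have h0 : dualityMap r (0 : E) = 0 := by simp [dualityMap]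
    rw [ContinuousAt, h0, tendsto_zero_iff_norm_tendsto_zero]
    simp_rw [norm_dualityMap hr]
    have : Continuous fun x : E => ‖x‖ ^ (r - 1) :=
      continuous_norm.rpow_const fun _ => Or.inr (by linarith)
    simpa [Real.zero_rpow (by linarith : r - 1 ≠ 0)] using this.tendsto 0
  · exact (continuous_norm.continuousAt.rpow_const (Or.inl (norm_ne_zero_iff.2 ha))).smul
      continuousAt_id

/-- The tangent inequality for the strictly convex function `|·|^r`. -/
theorem norm_rpow_tangent_lt {r : ℝ} (hr : 1 < r) {a b : E} (hab : a ≠ b) :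
    ‖a‖ ^ r + r * inner ℝ (dualityMap r a) (b - a) < ‖b‖ ^ r := by
  rcases eq_or_ne a 0 with rfl | ha
  · have hb : 0 < ‖b‖ := norm_pos_iff.2 hab.symm
    simpa [dualityMap, Real.zero_rpow (by linarith : r ≠ 0)] using Real.rpow_pos_of_pos hb r
  have ha' : 0 < ‖a‖ := norm_pos_iff.2 ha
  have hin : inner ℝ (dualityMap r a) (b - a) = ‖a‖ ^ (r - 2) * inner ℝ a b - ‖a‖ ^ r := by
    rw [inner_sub_right, inner_dualityMap_self hr, dualityMap, inner_smul_left, conj_trivial]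
  have hpos : 0 < ‖a‖ ^ (r - 2) := Real.rpow_pos_of_pos ha' _
  have e1 : ‖a‖ ^ (r - 2) * (‖a‖ * ‖b‖) = ‖a‖ ^ (r - 1) * ‖b‖ := by
    rw [← norm_rpow_sub_two_mul hr]; ring
  have e2 := norm_rpow_sub_one_mul hr a
  rw [hin]
  -- Strictness has two sources: Cauchy-Schwarz when the norms agree, and Bernoulli's inequality for
  -- the ratio `‖b‖ / ‖a‖` when they differ.
  rcases eq_or_ne ‖b‖ ‖a‖ with hn | hn
  · have hlt : inner ℝ a b < ‖a‖ * ‖b‖ := by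
      rw [inner_lt_norm_mul_iff_real, hn]
      exact fun h => hab (smul_right_injective E ha'.ne' h)
    have := mul_lt_mul_of_pos_left hlt hpos
    rw [e1, hn, e2] at this
    rw [hn]
    nlinarith
  · have hle := mul_le_mul_of_nonneg_left (real_inner_le_norm a b) hpos.le
    rw [e1] at hle
    have hB := one_add_mul_self_lt_rpow_one_add (s := ‖b‖ / ‖a‖ - 1)
      (by have : 0 ≤ ‖b‖ / ‖a‖ := by positivity
          linarith)
      (by rw [sub_ne_zero]; exact fun h => hn ((div_eq_one_iff_eq ha'.ne').1 h)) hr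
    rw [add_sub_cancel, Real.div_rpow (norm_nonneg _) (norm_nonneg _)] at hB
    have hB' := mul_lt_mul_of_pos_left hB (Real.rpow_pos_of_pos ha' r)
    rw [mul_div_cancel₀ _ (Real.rpow_pos_of_pos ha' r).ne'] at hB'
    have e3 : ‖a‖ ^ r * (1 + r * (‖b‖ / ‖a‖ - 1))
        = ‖a‖ ^ r + r * (‖a‖ ^ (r - 1) * ‖b‖ - ‖a‖ ^ r) := by
      rw [← e2]; field_simp
    rw [e3] at hB'
    nlinarith

theorem norm_rpow_tangent_le {r : ℝ} (hr : 1 < r) (a b : E) :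
    ‖a‖ ^ r + r * inner ℝ (dualityMap r a) (b - a) ≤ ‖b‖ ^ r := by
  rcases eq_or_ne a b with rfl | h
  · simp
  · exact (norm_rpow_tangent_lt hr h).le

/-- The pointwise form of Clarkson's inequality for exponents `q ≥ 2`. -/
theorem norm_rpow_clarkson {q : ℝ} (hq : 2 ≤ q) (a b : E) :
    ‖(1 / 2 : ℝ) • (a + b)‖ ^ q + ‖(1 / 2 : ℝ) • (a - b)‖ ^ q ≤ (‖a‖ ^ q + ‖b‖ ^ q) / 2 := by
  -- Written in squared norms, the claim follows from the superadditivity of `t ^ (q / 2)`, the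
  -- parallelogram law and the convexity of `t ^ (q / 2)`. The first and the last use `q / 2 ≥ 1`.
  have key : ∀ c : E, ‖c‖ ^ q = (‖c‖ ^ 2) ^ (q / 2) := fun c => by
    rw [← Real.rpow_natCast, ← Real.rpow_mul (norm_nonneg _)]
    congr 1; push_cast; ring
  simp_rw [key]
  have hq' : 1 ≤ q / 2 := by linarith
  have h1 : ∀ x y : ℝ, 0 ≤ x → 0 ≤ y → x ^ (q / 2) + y ^ (q / 2) ≤ (x + y) ^ (q / 2) := by
    intro x y hx hy
    lift x to NNReal using hx
    lift y to NNReal using hy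
    exact_mod_cast NNReal.add_rpow_le_rpow_add x y hq'
  refine (h1 _ _ (by positivity) (by positivity)).trans ?_
  have hpar : ‖(1 / 2 : ℝ) • (a + b)‖ ^ 2 + ‖(1 / 2 : ℝ) • (a - b)‖ ^ 2
      = (1 / 2 : ℝ) * ‖a‖ ^ 2 + (1 / 2 : ℝ) * ‖b‖ ^ 2 := by
    have := parallelogram_law_with_norm ℝ a b
    simp only [norm_smul, mul_pow]
    norm_num
    nlinarith
  rw [hpar]
  have := (convexOn_rpow hq').2 (Set.mem_Ici.2 (sq_nonneg ‖a‖)) (Set.mem_Ici.2 (sq_nonneg ‖b‖))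
    (by norm_num : (0 : ℝ) ≤ 1 / 2) (by norm_num : (0 : ℝ) ≤ 1 / 2) (by norm_num)
  simp only [smul_eq_mul] at this
  linarith

end DualityMap

/-! ### Integral forms of the duality map and of the tangent inequality -/

section Integral

variable {α : Type*} [MeasurableSpace α] {μ : Measure α}
  {E : Type*} [NormedAddCommGroup E] [InnerProductSpace ℝ E]

theorem memLp_integrable_norm_rpow {E : Type*} [NormedAddCommGroup E] {r : ℝ} (hr : 1 < r) {A : α → E}
    (hA : MemLp A (ENNReal.ofReal r) μ) : Integrable (fun x => ‖A x‖ ^ r) μ := by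
  have := hA.integrable_norm_rpow (by simp; linarith) ENNReal.ofReal_ne_top
  rwa [ENNReal.toReal_ofReal (by linarith)] at this

theorem eLpNorm_eq_ofReal_integral {E : Type*} [NormedAddCommGroup E] {r : ℝ} (hr : 1 < r) {A : α → E}
    (hA : MemLp A (ENNReal.ofReal r) μ) :
    eLpNorm A (ENNReal.ofReal r) μ = ENNReal.ofReal ((∫ x, ‖A x‖ ^ r ∂μ) ^ r⁻¹) := by
  rw [hA.eLpNorm_eq_integral_rpow_norm (by simp; linarith) ENNReal.ofReal_ne_top,
    ENNReal.toReal_ofReal (by linarith)]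

theorem eLpNorm_le_iff_integral_le {E : Type*} [NormedAddCommGroup E] {r : ℝ} (hr : 1 < r) {A B : α → E}
    (hA : MemLp A (ENNReal.ofReal r) μ) (hB : MemLp B (ENNReal.ofReal r) μ) :
    eLpNorm A (ENNReal.ofReal r) μ ≤ eLpNorm B (ENNReal.ofReal r) μ ↔
      ∫ x, ‖A x‖ ^ r ∂μ ≤ ∫ x, ‖B x‖ ^ r ∂μ := by
  have h0 : ∀ C : α → E, 0 ≤ ∫ x, ‖C x‖ ^ r ∂μ := fun C => integral_nonneg fun x => by positivity
  rw [eLpNorm_eq_ofReal_integral hr hA, eLpNorm_eq_ofReal_integral hr hB,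
    ENNReal.ofReal_le_ofReal_iff (Real.rpow_nonneg (h0 B) _),
    Real.rpow_le_rpow_iff (h0 A) (h0 B) (by positivity)]

theorem norm_Lp_rpow {E : Type*} [NormedAddCommGroup E] {r : ℝ} (hr : 1 < r) (A : Lp E (ENNReal.ofReal r) μ) :
    ‖A‖ ^ r = ∫ x, ‖A x‖ ^ r ∂μ := by
  have h0 : 0 ≤ ∫ x, ‖A x‖ ^ r ∂μ := integral_nonneg fun x => by positivity
  rw [Lp.norm_def, eLpNorm_eq_ofReal_integral hr (Lp.memLp A),
    ENNReal.toReal_ofReal (by positivity), ← Real.rpow_mul h0, inv_mul_cancel₀ (by linarith),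
    Real.rpow_one]

theorem memLp_dualityMap {r s : ℝ} (h : r.HolderConjugate s) {A : α → E}
    (hA : MemLp A (ENNReal.ofReal r) μ) :
    MemLp (fun x => dualityMap r (A x)) (ENNReal.ofReal s) μ := by
  have hm : AEStronglyMeasurable (fun x => dualityMap r (A x)) μ :=
    (continuous_dualityMap h.lt).comp_aestronglyMeasurable hA.1
  have hr1 : 0 < r - 1 := by have := h.lt; linarith
  rw [← memLp_norm_iff hm]
  simp_rw [norm_dualityMap h.lt]
  have := hA.norm_rpow_div (ENNReal.ofReal (r - 1))
  rwa [ENNReal.toReal_ofReal hr1.le, ← ENNReal.ofReal_div_of_pos hr1,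
    ← h.conjugate_eq] at this

theorem integrable_inner_of_holderConjugate {r s : ℝ} (h : r.HolderConjugate s) {A B : α → E}
    (hA : MemLp A (ENNReal.ofReal r) μ) (hB : MemLp B (ENNReal.ofReal s) μ) :
    Integrable (fun x => inner ℝ (A x) (B x)) μ := by
  have := h.ennrealOfReal
  exact memLp_one_iff_integrable.1 ((innerSL ℝ (E := E)).memLp_of_bilin (r := 1) hA hB)

/-- Integrating the tangent inequality at `A x` removes the linear term by orthogonality. If the
norms agree, the non-negative defect has integral zero, so it vanishes almost everywhere, and
strictness forces `B = A`. -/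
theorem integral_norm_rpow_le_of_inner_eq_zero {r s : ℝ} (h : r.HolderConjugate s) {A B : α → E}
    (hA : MemLp A (ENNReal.ofReal r) μ) (hB : MemLp B (ENNReal.ofReal r) μ)
    (h0 : ∫ x, inner ℝ (dualityMap r (A x)) (B x - A x) ∂μ = 0) :
    eLpNorm A (ENNReal.ofReal r) μ ≤ eLpNorm B (ENNReal.ofReal r) μ ∧
      (eLpNorm B (ENNReal.ofReal r) μ ≤ eLpNorm A (ENNReal.ofReal r) μ → B =ᵐ[μ] A) := by
  have iA := memLp_integrable_norm_rpow h.lt hA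
  have iB := memLp_integrable_norm_rpow h.lt hB
  have iI : Integrable (fun x => inner ℝ (dualityMap r (A x)) (B x - A x)) μ :=
    integrable_inner_of_holderConjugate h.symm (memLp_dualityMap h hA) (hB.sub hA)
  have iG : Integrable (fun x => ‖B x‖ ^ r - (‖A x‖ ^ r
      + r * inner ℝ (dualityMap r (A x)) (B x - A x))) μ := iB.sub (iA.add (iI.const_mul r))
  have hG : ∫ x, (‖B x‖ ^ r - (‖A x‖ ^ r + r * inner ℝ (dualityMap r (A x)) (B x - A x))) ∂μ
      = (∫ x, ‖B x‖ ^ r ∂μ) - ∫ x, ‖A x‖ ^ r ∂μ := by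
    have e := integral_add iA (iI.const_mul r)
    rw [integral_const_mul, h0, mul_zero, add_zero] at e
    rw [← e]
    exact integral_sub iB (iA.add (iI.const_mul r))
  have hnn : ∀ x, 0 ≤ ‖B x‖ ^ r - (‖A x‖ ^ r + r * inner ℝ (dualityMap r (A x)) (B x - A x)) :=
    fun x => sub_nonneg.2 (norm_rpow_tangent_le h.lt _ _)
  rw [eLpNorm_le_iff_integral_le h.lt hA hB, eLpNorm_le_iff_integral_le h.lt hB hA]
  refine ⟨?_, fun hle => ?_⟩
  · have := integral_nonneg_of_ae (ae_of_all μ hnn)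
    rw [hG] at this
    linarith
  · have hz : ∫ x, (‖B x‖ ^ r - (‖A x‖ ^ r
        + r * inner ℝ (dualityMap r (A x)) (B x - A x))) ∂μ = 0 :=
      le_antisymm (by rw [hG]; linarith) (integral_nonneg_of_ae (ae_of_all _ hnn))
    rw [integral_eq_zero_iff_of_nonneg hnn iG] at hz
    filter_upwards [hz] with x hx
    by_contra hne
    have := norm_rpow_tangent_lt h.lt (Ne.symm hne)
    simp only [Pi.zero_apply] at hx
    linarith

end Integral

/-! ### Minimization of `‖D w‖^q / q + L w` for exponents `q ≥ 2` -/

section Minimization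

open Filter Topology

variable {α : Type*} [MeasurableSpace α] {μ : Measure α}
  {E : Type*} [NormedAddCommGroup E] [InnerProductSpace ℝ E]

theorem norm_Lp_rpow_clarkson {q : ℝ} (hq : 2 ≤ q) [Fact (1 ≤ ENNReal.ofReal q)]
    (a b : Lp E (ENNReal.ofReal q) μ) :
    ‖(1 / 2 : ℝ) • (a + b)‖ ^ q + ‖(1 / 2 : ℝ) • (a - b)‖ ^ q ≤ (‖a‖ ^ q + ‖b‖ ^ q) / 2 := by
  have hq1 : 1 < q := by linarith
  have hi : ∀ c : Lp E (ENNReal.ofReal q) μ, Integrable (fun x => ‖c x‖ ^ q) μ :=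
    fun c => memLp_integrable_norm_rpow hq1 (Lp.memLp c)
  simp_rw [norm_Lp_rpow hq1]
  rw [← integral_add (hi _) (hi _), ← integral_add (hi _) (hi _), ← integral_div]
  refine integral_mono_ae ((hi _).add (hi _)) (((hi _).add (hi _)).div_const 2) ?_
  filter_upwards [Lp.coeFn_smul (1 / 2 : ℝ) (a + b), Lp.coeFn_smul (1 / 2 : ℝ) (a - b),
    Lp.coeFn_add a b, Lp.coeFn_sub a b] with x h1 h2 h3 h4
  simp only [h1, h2, h3, h4, Pi.smul_apply, Pi.add_apply, Pi.sub_apply]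
  exact norm_rpow_clarkson hq _ _

variable {X : Type*} [NormedAddCommGroup X] [NormedSpace ℝ X]

/-- Direct method with strong convergence: Clarkson's inequality bounds the distance of two
almost-minimizers by their excess over the infimum, so a minimizing sequence is Cauchy and its limit
is a minimizer by continuity. -/
theorem exists_minimizer_rpow_add_linear [CompleteSpace X] {q : ℝ} (hq : 2 ≤ q)
    [Fact (1 ≤ ENNReal.ofReal q)]
    (D : X →L[ℝ] Lp E (ENNReal.ofReal q) μ) (L : X →L[ℝ] ℝ) (C : ℝ)
    (hD : ∀ w, ‖w‖ ≤ C * ‖D w‖) :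
    ∃ w, ∀ v, ‖D w‖ ^ q / q + L w ≤ ‖D v‖ ^ q / q + L v := by
  have hq0 : 0 < q := by linarith
  set J : X → ℝ := fun w => ‖D w‖ ^ q / q + L w with hJ
  have hJc : Continuous J := by
    refine Continuous.add (Continuous.div_const ?_ q) L.continuous
    exact (continuous_norm.comp D.continuous).rpow_const fun _ => Or.inr hq0.le
  have hpq : q.HolderConjugate (Real.conjExponent q) := Real.HolderConjugate.conjExponent (by linarith)
  -- Young's inequality absorbs the linear term, which is at most `‖L‖ * |C| * ‖D w‖`, into `‖D w‖ ^
  -- q / q`.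
  have hlow : ∀ w, -((‖L‖ * |C|) ^ (Real.conjExponent q) / Real.conjExponent q) ≤ J w := by
    intro w
    have h1 : -(‖D w‖ * (‖L‖ * |C|)) ≤ L w := by
      have h2 : ‖L w‖ ≤ ‖L‖ * ‖w‖ := L.le_opNorm w
      have h3 : ‖w‖ ≤ |C| * ‖D w‖ :=
        (hD w).trans (mul_le_mul_of_nonneg_right (le_abs_self C) (norm_nonneg _))
      have h4 : ‖L‖ * ‖w‖ ≤ ‖L‖ * (|C| * ‖D w‖) := mul_le_mul_of_nonneg_left h3 (norm_nonneg _)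
      have h5 := neg_abs_le (L w)
      rw [Real.norm_eq_abs] at h2
      nlinarith
    have h6 := Real.young_inequality_of_nonneg (norm_nonneg (D w))
      (by positivity : 0 ≤ ‖L‖ * |C|) hpq
    simp only [hJ]
    linarith
  have hbdd : BddBelow (Set.range J) := ⟨_, by rintro _ ⟨w, rfl⟩; exact hlow w⟩
  set m := ⨅ w, J w with hm
  have hmle : ∀ w, m ≤ J w := fun w => ciInf_le hbdd w
  have hex : ∀ n : ℕ, ∃ w, J w < m + 1 / ((n : ℝ) + 1) := fun n =>
    exists_lt_of_ciInf_lt (lt_add_of_pos_right m (by positivity))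
  choose w hw using hex
  -- The midpoint of `a` and `b` has energy at least `m`. The linear part is the same on both sides,
  -- so Clarkson's inequality leaves only the difference term.
  have hclark : ∀ a b, ‖D (a - b)‖ ^ q ≤ 2 ^ q * (q * ((J a + J b) / 2 - m)) := by
    intro a b
    have h1 := norm_Lp_rpow_clarkson hq (D a) (D b)
    have h2 := hmle ((1 / 2 : ℝ) • (a + b))
    simp only [hJ, map_smul, map_add, smul_eq_mul] at h2
    have h3 : ‖(1 / 2 : ℝ) • (D a - D b)‖ ^ q = ‖D (a - b)‖ ^ q / 2 ^ q := by
      rw [map_sub, norm_smul, Real.norm_of_nonneg (by norm_num), one_div_mul_eq_div,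
        Real.div_rpow (norm_nonneg _) (by norm_num)]
    rw [h3] at h1
    have h4 : ‖D (a - b)‖ ^ q / 2 ^ q ≤ q * ((J a + J b) / 2 - m) := by
      have e : q * ((J a + J b) / 2 - m) = (‖D a‖ ^ q + ‖D b‖ ^ q) / 2
          + q * ((L a + L b) / 2 - m) := by
        simp only [hJ]; field_simp; ring
      rw [e]
      have h5 := mul_le_mul_of_nonneg_left h2 hq0.le
      have e2 : q * (‖(1 / 2 : ℝ) • (D a + D b)‖ ^ q / q + 1 / 2 * (L a + L b))
          = ‖(1 / 2 : ℝ) • (D a + D b)‖ ^ q + q * ((L a + L b) / 2) := by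
        field_simp
      rw [smul_add] at e2 h1
      rw [smul_add, e2] at h5
      nlinarith
    rwa [div_le_iff₀' (by positivity)] at h4
  have hcau : CauchySeq w := by
    refine cauchySeq_of_le_tendsto_0
      (fun N : ℕ => |C| * (2 ^ q * (q * (1 / ((N : ℝ) + 1)))) ^ q⁻¹) ?_ ?_
    · intro n k N hn hk
      rw [dist_eq_norm]
      refine (hD _).trans (mul_le_mul (le_abs_self C) ?_ (norm_nonneg _) (abs_nonneg _))
      rw [Real.le_rpow_inv_iff_of_pos (norm_nonneg _) (by positivity) hq0]
      refine (hclark _ _).trans ?_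
      have hmono : ∀ i, N ≤ i → J (w i) ≤ m + 1 / ((N : ℝ) + 1) := fun i hi =>
        (hw i).le.trans (add_le_add_right (one_div_le_one_div_of_le (by positivity)
          (by have : (N : ℝ) ≤ i := by exact_mod_cast hi
              linarith)) m)
      have := hmono n hn
      have := hmono k hk
      gcongr
      linarith
    · have h0 : Tendsto (fun N : ℕ => 2 ^ q * (q * (1 / ((N : ℝ) + 1)))) atTop (𝓝 0) := by
        have := (tendsto_one_div_add_atTop_nhds_zero_nat (𝕜 := ℝ)).const_mul q |>.const_mul (2 ^ q)
        simpa using this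
      have := (h0.rpow_const (p := q⁻¹) (Or.inr (by positivity))).const_mul |C|
      rwa [Real.zero_rpow (by positivity), mul_zero] at this
  obtain ⟨w₀, hw₀⟩ := cauchySeq_tendsto_of_complete hcau
  refine ⟨w₀, fun v => le_trans ?_ (hmle v)⟩
  have h1 : Tendsto (fun n => J (w n)) atTop (𝓝 (J w₀)) := (hJc.tendsto w₀).comp hw₀
  have h2 : Tendsto (fun n : ℕ => m + 1 / ((n : ℝ) + 1)) atTop (𝓝 m) := by
    simpa using (tendsto_one_div_add_atTop_nhds_zero_nat (𝕜 := ℝ)).const_add m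
  exact le_of_tendsto_of_tendsto' h1 h2 fun n => (hw n).le

/-- Dominated convergence: for `0 < t < 1` the integrand is bounded by `(‖a‖ + ‖b‖) ^ (q - 1) *
‖b‖`, which is integrable by Hölder's inequality. -/
theorem tendsto_integral_inner_dualityMap {q s : ℝ} (h : q.HolderConjugate s) {a b : α → E}
    (ha : MemLp a (ENNReal.ofReal q) μ) (hb : MemLp b (ENNReal.ofReal q) μ) :
    Tendsto (fun t : ℝ => ∫ x, inner ℝ (dualityMap q (a x + t • b x)) (b x) ∂μ) (𝓝[>] 0)
      (𝓝 (∫ x, inner ℝ (dualityMap q (a x)) (b x) ∂μ)) := by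
  have hq := h.lt
  have hmeas : ∀ t : ℝ, MemLp (fun x => dualityMap q (a x + t • b x)) (ENNReal.ofReal s) μ :=
    fun t => memLp_dualityMap h (ha.add (hb.const_smul t))
  have hN : MemLp (fun x => ‖a x‖ + ‖b x‖) (ENNReal.ofReal q) μ := ha.norm.add hb.norm
  refine tendsto_integral_filter_of_dominated_convergence
    (fun x => (‖a x‖ + ‖b x‖) ^ (q - 1) * ‖b x‖) ?_ ?_ ?_ ?_
  · exact Eventually.of_forall fun t => (integrable_inner_of_holderConjugate h.symm (hmeas t) hb).1
  · filter_upwards [Ioo_mem_nhdsGT (zero_lt_one (α := ℝ))] with t ht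
    refine Eventually.of_forall fun x => (norm_inner_le_norm _ _).trans ?_
    rw [norm_dualityMap hq]
    have : ‖a x + t • b x‖ ≤ ‖a x‖ + ‖b x‖ := by
      refine (norm_add_le _ _).trans (add_le_add_right ?_ _)
      rw [norm_smul, Real.norm_of_nonneg ht.1.le]
      exact mul_le_of_le_one_left (norm_nonneg _) ht.2.le
    gcongr
  · have h1 := memLp_dualityMap h hN
    have h2 := integrable_inner_of_holderConjugate h.symm h1 hb.norm
    refine h2.congr (Eventually.of_forall fun x => ?_)
    simp only [dualityMap, smul_eq_mul, RCLike.inner_apply, conj_trivial]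
    have := norm_rpow_sub_two_mul hq (‖a x‖ + ‖b x‖)
    rw [Real.norm_of_nonneg (by positivity : 0 ≤ ‖a x‖ + ‖b x‖)] at this ⊢
    rw [this, mul_comm]
  · refine Eventually.of_forall fun x => ?_
    have hc : Continuous fun t : ℝ => inner ℝ (dualityMap q (a x + t • b x)) (b x) :=
      (((continuous_dualityMap hq).comp (by fun_prop)).inner continuous_const)
    have := (hc.tendsto 0).mono_left (nhdsWithin_le_nhds (s := Set.Ioi 0))
    simpa using this

/-- The Euler-Lagrange equation of the convex functional `‖D w‖^q / q + L w`, which has a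
minimizer when `D` is bounded below. -/
theorem exists_eulerLagrange_rpow_add_linear [CompleteSpace X] {q s : ℝ} (hq : 2 ≤ q)
    (h : q.HolderConjugate s) [Fact (1 ≤ ENNReal.ofReal q)]
    (D : X →L[ℝ] Lp E (ENNReal.ofReal q) μ) (L : X →L[ℝ] ℝ) (C : ℝ)
    (hD : ∀ w, ‖w‖ ≤ C * ‖D w‖) :
    ∃ w, ∀ v, (∫ x, inner ℝ (dualityMap q (D w x)) (D v x) ∂μ) + L v = 0 := by
  obtain ⟨w, hw⟩ := exists_minimizer_rpow_add_linear hq D L C hD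
  have hq1 := h.lt
  -- The norm power is never differentiated under the integral. The tangent inequality based at `D w
  -- + t • D v` and evaluated at `D w`, together with minimality of `w`, gives the sign with `D w +
  -- t • D v` inside the duality map; then `t → 0+`. The direction `-v` yields equality.
  have hnn : ∀ v, 0 ≤ (∫ x, inner ℝ (dualityMap q (D w x)) (D v x) ∂μ) + L v := by
    intro v
    have hlim := (tendsto_integral_inner_dualityMap h (Lp.memLp (D w)) (Lp.memLp (D v))).add_const
      (L v)
    refine ge_of_tendsto hlim ?_
    filter_upwards [self_mem_nhdsWithin] with t ht
    have ht0 : (0 : ℝ) < t := ht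
    have hmin := hw (w + t • v)
    simp only [map_add, map_smul, norm_Lp_rpow hq1, smul_eq_mul] at hmin
    have hae : ∀ᵐ x ∂μ, (D w + t • D v) x = D w x + t • D v x := by
      filter_upwards [Lp.coeFn_add (D w) (t • D v), Lp.coeFn_smul t (D v)] with x h1 h2
      rw [h1, Pi.add_apply, h2, Pi.smul_apply]
    have hval : ∫ x, ‖(D w + t • D v) x‖ ^ q ∂μ = ∫ x, ‖D w x + t • D v x‖ ^ q ∂μ :=
      integral_congr_ae (hae.mono fun x hx => by simp only [hx])
    rw [hval] at hmin
    have hAm : MemLp (fun x => D w x + t • D v x) (ENNReal.ofReal q) μ :=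
      (Lp.memLp (D w)).add ((Lp.memLp (D v)).const_smul t)
    have iA := memLp_integrable_norm_rpow hq1 hAm
    have iI := integrable_inner_of_holderConjugate h.symm (memLp_dualityMap h hAm) (Lp.memLp (D v))
    have hconv : (∫ x, ‖D w x + t • D v x‖ ^ q ∂μ)
        - q * t * ∫ x, inner ℝ (dualityMap q (D w x + t • D v x)) (D v x) ∂μ
        ≤ ∫ x, ‖D w x‖ ^ q ∂μ := by
      rw [← integral_const_mul, ← integral_sub iA (iI.const_mul _)]
      refine integral_mono (iA.sub (iI.const_mul _))
        (memLp_integrable_norm_rpow hq1 (Lp.memLp _)) fun x => ?_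
      have := norm_rpow_tangent_le hq1 (D w x + t • D v x) (D w x)
      rw [sub_add_cancel_left, inner_neg_right, inner_smul_right] at this
      simp only
      linarith
    set I := ∫ x, inner ℝ (dualityMap q (D w x + t • D v x)) (D v x) ∂μ
    have hq0 : 0 < q := by linarith
    have h5 : (∫ x, ‖D w x‖ ^ q ∂μ) / q ≥ (∫ x, ‖D w x + t • D v x‖ ^ q ∂μ) / q - t * I := by
      rw [ge_iff_le, div_sub' hq0.ne', div_le_div_iff_of_pos_right hq0]
      linarith
    have h6 : 0 ≤ t * (I + L v) := by linarith
    exact nonneg_of_mul_nonneg_right h6 ht0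
  refine ⟨w, fun v => le_antisymm ?_ (hnn v)⟩
  have h1 := hnn (-v)
  have hae : ∫ x, inner ℝ (dualityMap q (D w x)) (D (-v) x) ∂μ
      = - ∫ x, inner ℝ (dualityMap q (D w x)) (D v x) ∂μ := by
    rw [← integral_neg]
    refine integral_congr_ae ?_
    rw [map_neg]
    filter_upwards [Lp.coeFn_neg (D v)] with x hx
    rw [hx, Pi.neg_apply, inner_neg_right]
  rw [hae, map_neg] at h1
  linarith

end Minimization

/-! ### Weak gradients -/

section Test

variable {d : ℕ} {Ω : Set (Vec d)}

theorem gradient_apply (φ : Vec d → ℝ) (x : Vec d) (i : Fin d) :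
    gradient φ x i = fderiv ℝ φ x (EuclideanSpace.single i (1 : ℝ)) := by
  have h : inner ℝ (gradient φ x) (EuclideanSpace.single i (1 : ℝ))
      = fderiv ℝ φ x (EuclideanSpace.single i (1 : ℝ)) := by
    rw [gradient, InnerProductSpace.toDual_symm_apply]
  rw [← h, EuclideanSpace.inner_single_right]
  simp

theorem IsTest.contDiff_one {φ : Vec d → ℝ} (hφ : IsTest Ω φ) : ContDiff ℝ 1 φ :=
  hφ.1.of_le (by exact_mod_cast le_top)

theorem IsTest.continuous_gradient {φ : Vec d → ℝ} (hφ : IsTest Ω φ) :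
    Continuous (gradient φ) :=
  (InnerProductSpace.toDual ℝ (Vec d)).symm.continuous.comp
    (hφ.contDiff_one.continuous_fderiv one_ne_zero)

theorem gradient_eq_zero_of_notMem_tsupport {φ : Vec d → ℝ} {x : Vec d} (hx : x ∉ tsupport φ) :
    gradient φ x = 0 := by
  have : fderiv ℝ φ x = 0 := by
    by_contra h
    exact hx (support_fderiv_subset ℝ h)
  rw [gradient, this, map_zero]

theorem IsTest.hasCompactSupport_gradient {φ : Vec d → ℝ} (hφ : IsTest Ω φ) :
    HasCompactSupport (gradient φ) :=
  HasCompactSupport.intro hφ.2.1 fun _ hx => gradient_eq_zero_of_notMem_tsupport hx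

theorem IsTest.memLp {φ : Vec d → ℝ} (hφ : IsTest Ω φ) (q : ℝ≥0∞) :
    MemLp φ q (volume.restrict Ω) :=
  (hφ.1.continuous.memLp_of_hasCompactSupport hφ.2.1).restrict Ω

theorem IsTest.memLp_gradient {φ : Vec d → ℝ} (hφ : IsTest Ω φ) (q : ℝ≥0∞) :
    MemLp (gradient φ) q (volume.restrict Ω) :=
  (hφ.continuous_gradient.memLp_of_hasCompactSupport hφ.hasCompactSupport_gradient).restrict Ω

theorem IsTest.memLp_gradient_apply {φ : Vec d → ℝ} (hφ : IsTest Ω φ) (q : ℝ≥0∞) (i : Fin d) :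
    MemLp (fun x => gradient φ x i) q (volume.restrict Ω) :=
  (EuclideanSpace.proj (𝕜 := ℝ) i).comp_memLp' (hφ.memLp_gradient q)

/-- Integration by parts against a test function. -/
theorem IsTest.integral_mul_gradient {φ ψ : Vec d → ℝ} (hφ : IsTest Ω φ) (hψ : ContDiff ℝ 1 ψ)
    (i : Fin d) :
    ∫ x in Ω, ψ x * gradient φ x i = - ∫ x in Ω, gradient ψ x i * φ x := by
  have hz : ∀ x, x ∉ Ω → φ x = 0 := fun x hx =>
    image_eq_zero_of_notMem_tsupport fun h => hx (hφ.2.2 h)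
  have hz' : ∀ x, x ∉ Ω → gradient φ x i = 0 := fun x hx => by
    rw [gradient_eq_zero_of_notMem_tsupport fun h => hx (hφ.2.2 h)]; rfl
  rw [setIntegral_eq_integral_of_forall_compl_eq_zero fun x hx => by rw [hz' x hx, mul_zero],
    setIntegral_eq_integral_of_forall_compl_eq_zero fun x hx => by rw [hz x hx, mul_zero]]
  simp_rw [gradient_apply]
  have hcψ : Continuous fun x => fderiv ℝ ψ x (EuclideanSpace.single i (1 : ℝ)) :=
    (hψ.continuous_fderiv one_ne_zero).clm_apply continuous_const
  have hcφ : Continuous fun x => fderiv ℝ φ x (EuclideanSpace.single i (1 : ℝ)) :=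
    (hφ.contDiff_one.continuous_fderiv one_ne_zero).clm_apply continuous_const
  refine integral_mul_fderiv_eq_neg_fderiv_mul_of_integrable ?_ ?_ ?_
    (fun x _ => hψ.differentiable one_ne_zero x)
    (fun x _ => hφ.contDiff_one.differentiable one_ne_zero x)
  · exact (hcψ.mul hφ.1.continuous).integrable_of_hasCompactSupport hφ.2.1.mul_left
  · refine (hψ.continuous.mul hcφ).integrable_of_hasCompactSupport ?_
    exact HasCompactSupport.mul_left (hφ.2.1.fderiv_apply ℝ _)
  · exact (hψ.continuous.mul hφ.1.continuous).integrable_of_hasCompactSupport hφ.2.1.mul_left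

theorem IsTest.memW1 {φ : Vec d → ℝ} (hφ : IsTest Ω φ) (q : ℝ≥0∞) :
    MemW1 Ω q φ (gradient φ) :=
  ⟨hφ.memLp q, hφ.memLp_gradient q, fun _ hψ i => hψ.integral_mul_gradient hφ.contDiff_one i⟩

theorem IsTest.integral_gradient {φ : Vec d → ℝ} (hφ : IsTest Ω φ) (i : Fin d) :
    ∫ x in Ω, gradient φ x i = 0 := by
  have := hφ.integral_mul_gradient (contDiff_const (c := (1 : ℝ))) i
  simpa [gradient_apply] using this

theorem memW1_const [IsFiniteMeasure (volume.restrict Ω)] (q : ℝ≥0∞) (c : ℝ) :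
    MemW1 Ω q (fun _ => c) (fun _ => 0) := by
  refine ⟨memLp_const c, memLp_const 0, fun φ hφ i => ?_⟩
  rw [integral_const_mul, hφ.integral_gradient]
  simp

theorem MemW1.congr {q : ℝ≥0∞} {u v : Vec d → ℝ} {g k : Vec d → Vec d} (h : MemW1 Ω q u g)
    (huv : u =ᵐ[volume.restrict Ω] v) (hgk : g =ᵐ[volume.restrict Ω] k) : MemW1 Ω q v k := by
  refine ⟨h.1.ae_eq huv, h.2.1.ae_eq hgk, fun φ hφ i => ?_⟩
  have h1 : ∫ x in Ω, v x * gradient φ x i = ∫ x in Ω, u x * gradient φ x i :=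
    integral_congr_ae (huv.mono fun x hx => by simp only [hx])
  have h2 : ∫ x in Ω, k x i * φ x = ∫ x in Ω, g x i * φ x :=
    integral_congr_ae (hgk.mono fun x hx => by simp only [hx])
  rw [h1, h2, h.2.2 φ hφ i]

theorem integrable_mul_of_isTest {u φ : Vec d → ℝ} {q : ℝ≥0∞} (hq : 1 ≤ q)
    [IsFiniteMeasure (volume.restrict Ω)] (hu : MemLp u q (volume.restrict Ω))
    (hφ : MemLp φ ∞ (volume.restrict Ω)) : Integrable (fun x => u x * φ x) (volume.restrict Ω) :=
  (hu.integrable hq).mul_of_top_left hφ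

theorem memLp_apply {q : ℝ≥0∞} {g : Vec d → Vec d} (hg : MemLp g q (volume.restrict Ω))
    (i : Fin d) : MemLp (fun x => g x i) q (volume.restrict Ω) :=
  (EuclideanSpace.proj (𝕜 := ℝ) i).comp_memLp' hg

theorem MemW1.sub [IsFiniteMeasure (volume.restrict Ω)] {q : ℝ≥0∞} (hq : 1 ≤ q)
    {u v : Vec d → ℝ} {g k : Vec d → Vec d} (hu : MemW1 Ω q u g) (hv : MemW1 Ω q v k) :
    MemW1 Ω q (fun x => u x - v x) (fun x => g x - k x) := by
  refine ⟨hu.1.sub hv.1, hu.2.1.sub hv.2.1, fun φ hφ i => ?_⟩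
  have e1 : ∫ x in Ω, (u x - v x) * gradient φ x i
      = (∫ x in Ω, u x * gradient φ x i) - ∫ x in Ω, v x * gradient φ x i := by
    rw [← integral_sub (integrable_mul_of_isTest hq hu.1 (hφ.memLp_gradient_apply ∞ i))
      (integrable_mul_of_isTest hq hv.1 (hφ.memLp_gradient_apply ∞ i))]
    simp_rw [sub_mul]
  have e2 : ∫ x in Ω, (g x - k x) i * φ x
      = (∫ x in Ω, g x i * φ x) - ∫ x in Ω, k x i * φ x := by
    rw [← integral_sub (integrable_mul_of_isTest hq (memLp_apply hu.2.1 i) (hφ.memLp ∞))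
      (integrable_mul_of_isTest hq (memLp_apply hv.2.1 i) (hφ.memLp ∞))]
    simp_rw [PiLp.sub_apply, sub_mul]
  rw [e1, e2, hu.2.2 φ hφ i, hv.2.2 φ hφ i]
  ring

end Test

/-! ### Functions with vanishing weak gradient -/

section ZeroGradient

open Filter Topology Metric

variable {d : ℕ} {Ω : Set (Vec d)}

/-- The mollification of a function with vanishing weak gradient has vanishing derivative. -/
theorem hasFDerivAt_convolution_zero {u : Vec d → ℝ} (hΩ : MeasurableSet Ω)
    (hu : IntegrableOn u Ω)
    (h0 : ∀ φ, IsTest Ω φ → ∀ i : Fin d, ∫ x in Ω, u x * gradient φ x i = 0)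
    (φ : ContDiffBump (0 : Vec d)) {x : Vec d} (hx : closedBall x φ.rOut ⊆ Ω) :
    HasFDerivAt (convolution (φ.normed volume) (Ω.indicator u)
      (ContinuousLinearMap.lsmul ℝ ℝ : ℝ →L[ℝ] ℝ →L[ℝ] ℝ) volume)
      (0 : Vec d →L[ℝ] ℝ) x := by
  set U := Ω.indicator u with hU
  have hUi : LocallyIntegrable U := (hu.integrable_indicator hΩ).locallyIntegrable
  set ρ := φ.normed (volume : Measure (Vec d)) with hρ
  have hρc : HasCompactSupport ρ := φ.hasCompactSupport_normed
  have hρd : ContDiff ℝ (⊤ : ℕ∞) ρ := φ.contDiff_normed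
  have hρ1 : ContDiff ℝ 1 ρ := φ.contDiff_normed
  have hder := hρc.hasFDerivAt_convolution_left (ContinuousLinearMap.lsmul ℝ ℝ : ℝ →L[ℝ] ℝ →L[ℝ] ℝ)
    hρ1 hUi x
  suffices hzero : convolution (fderiv ℝ ρ) U
      ((ContinuousLinearMap.lsmul ℝ ℝ : ℝ →L[ℝ] ℝ →L[ℝ] ℝ).precompL (Vec d)) volume x = 0 by
    rw [hzero] at hder
    exact hder
  refine ContinuousLinearMap.coe_injective
    ((EuclideanSpace.basisFun (Fin d) ℝ).toBasis.ext fun i => ?_)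
  have hint : ConvolutionExistsAt (fderiv ℝ ρ) U x
      ((ContinuousLinearMap.lsmul ℝ ℝ : ℝ →L[ℝ] ℝ →L[ℝ] ℝ).precompL (Vec d)) volume :=
    (hρc.fderiv ℝ).convolutionExists_left _ (hρ1.continuous_fderiv one_ne_zero) hUi x
  -- The reflected mollifier is a test function because its support lies in the ball contained in
  -- `Ω`. The derivative of the convolution at `x` is, up to sign, the pairing of `u` with its
  -- gradient.
  set ψ : Vec d → ℝ := fun t => ρ (x - t) with hψ
  have hψs : tsupport ψ ⊆ closedBall x φ.rOut := by
    refine closure_minimal (fun t ht => ?_) isClosed_closedBall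
    have : x - t ∈ ball (0 : Vec d) φ.rOut := by
      rw [← φ.support_normed_eq (μ := volume)]; exact ht
    rw [mem_ball_zero_iff] at this
    rw [mem_closedBall, dist_comm, dist_eq_norm]
    exact this.le
  have hψt : IsTest Ω ψ :=
    ⟨hρd.comp (contDiff_const.sub contDiff_id),
      (isCompact_closedBall x φ.rOut).of_isClosed_subset (isClosed_tsupport _) hψs,
      hψs.trans hx⟩
  have hg : ∀ t, gradient ψ t i = - fderiv ℝ ρ (x - t) (EuclideanSpace.single i 1) := by
    intro t
    rw [gradient_apply]
    have h1 : HasFDerivAt (fun t : Vec d => x - t) (-ContinuousLinearMap.id ℝ (Vec d)) t :=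
      (hasFDerivAt_id t).const_sub x
    have h2 := ((hρ1.differentiable one_ne_zero (x - t)).hasFDerivAt).comp t h1
    have h3 : fderiv ℝ ψ t = _ := h2.fderiv
    rw [h3]
    simp
  have hz := h0 ψ hψt i
  simp only [ContinuousLinearMap.coe_coe, OrthonormalBasis.coe_toBasis,
    EuclideanSpace.basisFun_apply]
  rw [convolution_eq_swap]
  rw [ContinuousLinearMap.integral_apply]
  · rw [zero_apply]
    rw [← integral_indicator hΩ] at hz
    rw [← neg_eq_zero, ← integral_neg, ← hz]
    refine integral_congr_ae (Eventually.of_forall fun t => ?_)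
    by_cases ht : t ∈ Ω
    · simp [ContinuousLinearMap.precompL_apply, hU, ht, hg, mul_comm]
    · simp [hU, ht]
  · exact hint.integrable_swap

/-- The mollifications are constant on the small ball and converge to `u` almost everywhere. The
doubled radius leaves room for the supports of the mollifiers. -/
theorem exists_const_ae_eq_of_forall_isTest_ball {u : Vec d → ℝ} (hΩ : MeasurableSet Ω)
    (hu : IntegrableOn u Ω)
    (h0 : ∀ φ, IsTest Ω φ → ∀ i : Fin d, ∫ x in Ω, u x * gradient φ x i = 0)
    {x₀ : Vec d} {r : ℝ} (hr : 0 < r) (hx : ball x₀ (2 * r) ⊆ Ω) :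
    ∃ c, ∀ᵐ x, x ∈ ball x₀ r → u x = c := by
  -- The outer radius `r / (n + 3)` stays below `r` and tends to zero; its fixed ratio 2 to the
  -- inner radius is the bound `K = 2` required for almost everywhere convergence.
  set φ : ℕ → ContDiffBump (0 : Vec d) := fun n =>
    ⟨r / (n + 3) / 2, r / (n + 3), by positivity, half_lt_self (by positivity)⟩ with hφ
  have hUi : LocallyIntegrable (Ω.indicator u) := (hu.integrable_indicator hΩ).locallyIntegrable
  have hlim : Tendsto (fun n => (φ n).rOut) atTop (𝓝 0) := by
    have := (tendsto_natCast_atTop_atTop (R := ℝ)).atTop_add (tendsto_const_nhds (x := (3 : ℝ)))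
    exact this.const_div_atTop r
  have hae := ContDiffBump.ae_convolution_tendsto_right_of_locallyIntegrable (μ := volume)
    (K := 2) hlim (Eventually.of_forall fun n => by simp only [hφ]; linarith) hUi
  set V : ℕ → Vec d → ℝ := fun n => convolution ((φ n).normed volume) (Ω.indicator u)
    (ContinuousLinearMap.lsmul ℝ ℝ : ℝ →L[ℝ] ℝ →L[ℝ] ℝ) volume with hV
  have hconst : ∀ n, ∀ x ∈ ball x₀ r, ∀ y ∈ ball x₀ r, V n x = V n y := by
    intro n x hxb y hyb
    have hd : ∀ z ∈ ball x₀ r, HasFDerivAt (V n) (0 : Vec d →L[ℝ] ℝ) z := fun z hz => by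
      refine hasFDerivAt_convolution_zero hΩ hu h0 (φ n) (fun t ht => hx ?_)
      have h1 : (φ n).rOut < r := by
        simp only [hφ]
        rw [div_lt_iff₀ (by positivity)]
        have : (0 : ℝ) ≤ n := n.cast_nonneg
        nlinarith
      have h2 := dist_triangle t z x₀
      rw [mem_closedBall] at ht
      rw [mem_ball] at hz ⊢
      linarith
    refine (convex_ball x₀ r).is_const_of_fderivWithin_eq_zero (𝕜 := ℝ)
      (fun z hz => (hd z hz).differentiableAt.differentiableWithinAt) (fun z hz => ?_) hxb hyb
    exact (hd z hz).hasFDerivWithinAt.fderivWithin (isOpen_ball.uniqueDiffWithinAt hz)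
  have hpos : volume (ball x₀ r) ≠ 0 := (measure_ball_pos volume x₀ hr).ne'
  obtain ⟨x₁, hx₁, hx₁lim⟩ : ∃ x ∈ ball x₀ r,
      Tendsto (fun n => V n x) atTop (𝓝 (Ω.indicator u x)) := by
    by_contra! hcon
    exact hpos (measure_mono_null (fun x hxb => hcon x hxb) hae)
  refine ⟨Ω.indicator u x₁, hae.mono fun x hxl hxb => ?_⟩
  have hxΩ : x ∈ Ω := hx (ball_subset_ball (by linarith) hxb)
  have h1 : Tendsto (fun n => V n x₁) atTop (𝓝 (Ω.indicator u x)) :=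
    hxl.congr fun n => hconst n x hxb x₁ hx₁
  rw [← Set.indicator_of_mem hxΩ u]
  exact tendsto_nhds_unique h1 hx₁lim

/-- A function with vanishing weak gradient on a connected open set is constant. -/
theorem exists_const_ae_eq_of_forall_isTest {u : Vec d → ℝ} (hΩ : IsOpen Ω)
    (hc : IsPreconnected Ω) (hu : IntegrableOn u Ω)
    (h0 : ∀ φ, IsTest Ω φ → ∀ i : Fin d, ∫ x in Ω, u x * gradient φ x i = 0) :
    ∃ c, u =ᵐ[volume.restrict Ω] fun _ => c := by
  have hloc : ∀ x : Vec d, ∃ r : ℝ, ∃ c : ℝ, x ∈ Ω → 0 < r ∧ ball x r ⊆ Ω ∧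
      ∀ᵐ y, y ∈ ball x r → u y = c := by
    intro x
    by_cases hx : x ∈ Ω
    · obtain ⟨ε, hε, hεΩ⟩ := Metric.isOpen_iff.1 hΩ x hx
      obtain ⟨c, hc⟩ := exists_const_ae_eq_of_forall_isTest_ball hΩ.measurableSet hu h0
        (half_pos hε) (x₀ := x) (by rwa [mul_div_cancel₀ _ two_ne_zero])
      exact ⟨ε / 2, c, fun _ => ⟨half_pos hε,
        (ball_subset_ball (by linarith)).trans hεΩ, hc⟩⟩
    · exact ⟨0, 0, fun h => absurd h hx⟩
  choose r c hrc using hloc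
  -- The local constants agree at nearby centres, since overlapping balls meet in a set of positive
  -- measure. Connectedness propagates the equality.
  have hcc : ∀ x ∈ Ω, ∀ y ∈ Ω, c x = c y := by
    intro x hx y hy
    refine hc.induction₂ (fun a b => c a = c b) (fun a ha => ?_)
      (fun _ _ _ _ _ _ h1 h2 => h1.trans h2) (fun _ _ _ _ h => h.symm) hx hy
    obtain ⟨hra, -, hae⟩ := hrc a ha
    filter_upwards [nhdsWithin_le_nhds (ball_mem_nhds a hra), self_mem_nhdsWithin] with b hb hbΩ
    obtain ⟨hrb, -, hbe⟩ := hrc b hbΩ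
    have hopen : IsOpen (ball a (r a) ∩ ball b (r b)) := isOpen_ball.inter isOpen_ball
    have hpos := (hopen.measure_pos volume ⟨b, hb, mem_ball_self hrb⟩).ne'
    by_contra hne
    refine hpos (measure_mono_null (fun z hz => ?_) (hae.and hbe))
    exact fun hzz => hne ((hzz.1 hz.1).symm.trans (hzz.2 hz.2))
  rcases Ω.eq_empty_or_nonempty with rfl | ⟨x₀, hx₀⟩
  · exact ⟨0, by rw [Measure.restrict_empty, ae_zero]; exact Filter.eventually_bot⟩
  refine ⟨c x₀, (ae_restrict_iff' hΩ.measurableSet).2 ?_⟩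
  rw [ae_iff]
  refine measure_null_of_locally_null _ fun x hx => ?_
  have hxΩ : x ∈ Ω := by
    by_contra hcon
    exact hx fun h => absurd h hcon
  obtain ⟨hrx, -, hxe⟩ := hrc x hxΩ
  refine ⟨_, inter_mem (nhdsWithin_le_nhds (ball_mem_nhds x hrx)) self_mem_nhdsWithin, ?_⟩
  refine measure_mono_null (fun z hz => ?_) hxe
  exact fun hzz => hz.2 fun _ => (hzz hz.1).trans (hcc x hxΩ x₀ hx₀)

end ZeroGradient

/-! ### Continuous functionals on `L^q` and the Sobolev space of functions of mean zero -/

section Pairing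

variable {α : Type*} [MeasurableSpace α] {μ : Measure α}
  {E : Type*} [NormedAddCommGroup E] [InnerProductSpace ℝ E]
  {p q : ℝ≥0∞} [Fact (1 ≤ p)] [Fact (1 ≤ q)] [ENNReal.HolderConjugate p q]

/-- The continuous functional `w ↦ ∫ ⟨ψ, w⟩` on `L^q` defined by a function `ψ` of `L^p`. -/
def lpInner {ψ : α → E} (hψ : MemLp ψ p μ) (q : ℝ≥0∞) [Fact (1 ≤ q)]
    [ENNReal.HolderConjugate p q] : Lp E q μ →L[ℝ] ℝ :=
  (innerSL ℝ (E := E)).lpPairing μ p q hψ.toLp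

theorem lpInner_apply {ψ : α → E} (hψ : MemLp ψ p μ) (w : Lp E q μ) :
    lpInner hψ q w = ∫ x, inner ℝ (ψ x) (w x) ∂μ := by
  rw [lpInner, ContinuousLinearMap.lpPairing_eq_integral]
  refine integral_congr_ae ?_
  filter_upwards [hψ.coeFn_toLp] with x hx
  rw [hx, innerSL_apply_apply]

end Pairing

section CommonKernel

variable {ι X : Type*} [NormedAddCommGroup X] [NormedSpace ℝ X]

/-- The common kernel of a family of continuous functionals. -/
def commonKernel (F : ι → X →L[ℝ] ℝ) : Submodule ℝ X :=
  ⨅ i, LinearMap.ker (F i).toLinearMap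

theorem mem_commonKernel {F : ι → X →L[ℝ] ℝ} {w : X} :
    w ∈ commonKernel F ↔ ∀ i, F i w = 0 := by
  simp [commonKernel, Submodule.mem_iInf]

theorem isClosed_commonKernel (F : ι → X →L[ℝ] ℝ) : IsClosed (commonKernel F : Set X) := by
  rw [commonKernel, Submodule.coe_iInf]
  exact isClosed_iInter fun i => (F i).isClosed_ker

instance [CompleteSpace X] (F : ι → X →L[ℝ] ℝ) : CompleteSpace (commonKernel F) :=
  (isClosed_commonKernel F).completeSpace_coe

end CommonKernel

/-- In a topologically direct sum of the ranges of two injective operators, each of the operators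
is bounded below. -/
theorem exists_norm_le_of_directSum {X Y Z : Type*} [NormedAddCommGroup X] [NormedSpace ℝ X]
    [CompleteSpace X] [NormedAddCommGroup Y] [NormedSpace ℝ Y] [CompleteSpace Y]
    [NormedAddCommGroup Z] [NormedSpace ℝ Z] [CompleteSpace Z] (f : X →L[ℝ] Z) (g : Y →L[ℝ] Z)
    (hinj : ∀ x y, f x + g y = 0 → x = 0 ∧ y = 0) (hsurj : ∀ z, ∃ x y, f x + g y = z) :
    ∃ C : ℝ, 0 ≤ C ∧ ∀ x, ‖x‖ ≤ C * ‖f x‖ := by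
  have hker : LinearMap.ker (f.coprod g).toLinearMap = ⊥ := by
    rw [LinearMap.ker_eq_bot']
    rintro ⟨x, y⟩ hz
    obtain ⟨rfl, rfl⟩ := hinj x y hz
    rfl
  have hrange : LinearMap.range (f.coprod g).toLinearMap = ⊤ := by
    rw [LinearMap.range_eq_top]
    intro z
    obtain ⟨x, y, h⟩ := hsurj z
    exact ⟨(x, y), h⟩
  -- By the open mapping theorem the inverse is bounded; its first component is a bounded left
  -- inverse of `f`.
  set e := ContinuousLinearEquiv.ofBijective (f.coprod g) hker hrange with he
  set B := ContinuousLinearMap.fst ℝ X Y ∘L (e.symm : Z →L[ℝ] X × Y) with hB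
  refine ⟨‖B‖, norm_nonneg _, fun x => ?_⟩
  have h1 : e (x, 0) = f x := by
    change f x + g 0 = f x
    rw [map_zero, add_zero]
  have h2 : B (f x) = x := by
    rw [← h1, hB]
    simp
  have h3 := B.le_opNorm (f x)
  rwa [h2] at h3

/-! ### Mean-zero Sobolev functions, solenoidal fields and the Poincaré inequality -/

section Sobolev

variable {d : ℕ}

theorem memLp_single {Ω : Set (Vec d)} {ψ : Vec d → ℝ} {p : ℝ≥0∞}
    (hψ : MemLp ψ p (volume.restrict Ω)) (i : Fin d) :
    MemLp (fun x => (EuclideanSpace.single i (ψ x) : Vec d)) p (volume.restrict Ω) := by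
  refine MemLp.of_eval_piLp fun k => ?_
  by_cases h : k = i
  · subst h; simpa using hψ
  · simp [h]

variable (Ω : Set (Vec d)) [IsFiniteMeasure (volume.restrict Ω)] (p q : ℝ≥0∞)
  [Fact (1 ≤ p)] [Fact (1 ≤ q)] [ENNReal.HolderConjugate p q]

/-- Pairs of a function and a vector field in `L^q(Ω)`. -/
abbrev LpPair (q : ℝ≥0∞) : Type :=
  Lp ℝ q (volume.restrict Ω) × Lp (Vec d) q (volume.restrict Ω)

/-- The functionals on pairs `(u, g)` that vanish if and only if `g = ∇u` and `u` has mean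
zero. -/
def sobolevFunctional :
    Option ({φ : Vec d → ℝ // IsTest Ω φ} × Fin d) → LpPair Ω q →L[ℝ] ℝ
  | none => lpInner (memLp_const (1 : ℝ) : MemLp _ p (volume.restrict Ω)) q ∘L
      ContinuousLinearMap.fst ℝ _ _
  | some (φ, i) => lpInner (φ.2.memLp_gradient_apply p i) q ∘L ContinuousLinearMap.fst ℝ _ _ +
      lpInner (memLp_single (φ.2.memLp p) i) q ∘L ContinuousLinearMap.snd ℝ _ _

/-- The pairs `(u, ∇u)` with `u ∈ W^{1,q}(Ω)` of mean zero. -/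
def sobolevMeanZero : Submodule ℝ (LpPair Ω q) :=
  commonKernel (sobolevFunctional Ω p q)

/-- The space `H_q(Ω)` of solenoidal fields as a subspace of `L^q`. -/
def solenoidal : Submodule ℝ (Lp (Vec d) q (volume.restrict Ω)) :=
  commonKernel fun χ : {χ : (Vec d → ℝ) × (Vec d → Vec d) // MemW1 Ω p χ.1 χ.2} =>
    lpInner χ.2.2.1 q

instance : CompleteSpace (sobolevMeanZero Ω p q) :=
  inferInstanceAs (CompleteSpace (commonKernel _))

instance : CompleteSpace (solenoidal Ω p q) :=
  inferInstanceAs (CompleteSpace (commonKernel _))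

variable {Ω p q}

/-- Describing the space as a common kernel of continuous functionals serves to make it complete;
this is the description used afterwards. -/
theorem mem_sobolevMeanZero {w : LpPair Ω q} :
    w ∈ sobolevMeanZero Ω p q ↔ MemW1 Ω q w.1 w.2 ∧ ∫ x in Ω, w.1 x = 0 := by
  rw [sobolevMeanZero, mem_commonKernel, Option.forall, and_comm]
  refine and_congr ?_ ?_
  · constructor
    · intro h
      refine ⟨Lp.memLp _, Lp.memLp _, fun φ hφ i => ?_⟩
      have := h (⟨φ, hφ⟩, i)
      simp only [sobolevFunctional, add_apply,
        ContinuousLinearMap.comp_apply, ContinuousLinearMap.coe_fst',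
        ContinuousLinearMap.coe_snd', lpInner_apply, EuclideanSpace.inner_single_left,
        RCLike.inner_apply, conj_trivial] at this
      simp_rw [mul_comm (φ _)] at this
      linarith
    · rintro h ⟨⟨φ, hφ⟩, i⟩
      have := h.2.2 φ hφ i
      simp only [sobolevFunctional, add_apply,
        ContinuousLinearMap.comp_apply, ContinuousLinearMap.coe_fst',
        ContinuousLinearMap.coe_snd', lpInner_apply, EuclideanSpace.inner_single_left,
        RCLike.inner_apply, conj_trivial]
      simp_rw [mul_comm (φ _)]
      linarith
  · simp [sobolevFunctional, lpInner_apply]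

omit [IsFiniteMeasure (volume.restrict Ω)] in
theorem mem_solenoidal {h : Lp (Vec d) q (volume.restrict Ω)} :
    h ∈ solenoidal Ω p q ↔
      ∀ χ gχ, MemW1 Ω p χ gχ → ∫ x in Ω, inner ℝ (h x) (gχ x) = 0 := by
  rw [solenoidal, mem_commonKernel]
  simp only [lpInner_apply, Subtype.forall, Prod.forall]
  simp_rw [real_inner_comm]

theorem measureReal_restrict_ne_zero {Ω : Set (Vec d)} [IsFiniteMeasure (volume.restrict Ω)]
    (hΩ : IsOpen Ω) (hne : Ω.Nonempty) : (volume.restrict Ω).real Set.univ ≠ 0 := by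
  have h1 : volume Ω ≠ 0 := (hΩ.measure_pos volume hne).ne'
  have h2 : volume.restrict Ω Set.univ ≠ ∞ := measure_ne_top _ _
  rw [Measure.restrict_apply_univ] at h2
  rw [Measure.real, Measure.restrict_apply_univ]
  exact (ENNReal.toReal_pos h1 h2).ne'

/-- Subtraction of the mean value. -/
theorem exists_mem_sobolevMeanZero (hΩ : IsOpen Ω) (hne : Ω.Nonempty) {χ : Vec d → ℝ}
    {g : Vec d → Vec d} (h : MemW1 Ω q χ g) :
    ∃ w ∈ sobolevMeanZero Ω p q, ∃ c : ℝ,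
      w.1 =ᵐ[volume.restrict Ω] (fun x => χ x - c) ∧ w.2 =ᵐ[volume.restrict Ω] g := by
  have hq : 1 ≤ q := Fact.out
  set c : ℝ := (∫ x in Ω, χ x) / (volume.restrict Ω).real Set.univ with hc
  have hs : MemW1 Ω q (fun x => χ x - c) g :=
    (h.sub hq (memW1_const q c)).congr (ae_eq_refl _) (ae_of_all _ fun x => by simp)
  refine ⟨(hs.1.toLp, hs.2.1.toLp), mem_sobolevMeanZero.2 ⟨?_, ?_⟩, c, hs.1.coeFn_toLp,
    hs.2.1.coeFn_toLp⟩
  · exact hs.congr hs.1.coeFn_toLp.symm hs.2.1.coeFn_toLp.symm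
  · rw [integral_congr_ae hs.1.coeFn_toLp, integral_sub (h.1.integrable hq) (integrable_const c),
      integral_const, smul_eq_mul, hc, mul_div_cancel₀ _ (measureReal_restrict_ne_zero hΩ hne), sub_self]

/-- The Poincaré inequality follows from the Helmholtz decomposition by the open mapping
theorem. -/
theorem exists_poincare (hΩ : IsOpen Ω) (hc : IsConnected Ω)
    (hex : ∀ v : Vec d → Vec d, MemLp v q (volume.restrict Ω) →
      ∃ ϑ g h, MemW1 Ω q ϑ g ∧ (MemLp h q (volume.restrict Ω) ∧
        ∀ χ gχ, MemW1 Ω p χ gχ → ∫ x in Ω, inner ℝ (h x) (gχ x) = 0) ∧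
          v =ᵐ[volume.restrict Ω] g + h)
    (huniq : ∀ ϑ g, MemW1 Ω q ϑ g →
      (∀ χ gχ, MemW1 Ω p χ gχ → ∫ x in Ω, inner ℝ (g x) (gχ x) = 0) →
        g =ᵐ[volume.restrict Ω] 0) :
    ∃ C : ℝ, 0 ≤ C ∧ ∀ w ∈ sobolevMeanZero Ω p q, ‖w‖ ≤ C * ‖w.2‖ := by
  have hq : 1 ≤ q := Fact.out
  refine (exists_norm_le_of_directSum
    (ContinuousLinearMap.snd ℝ (Lp ℝ q (volume.restrict Ω)) (Lp (Vec d) q (volume.restrict Ω)) ∘L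
      (sobolevMeanZero Ω p q).subtypeL) (solenoidal Ω p q).subtypeL ?_ ?_).imp
    fun C hC => ⟨hC.1, fun w hw => hC.2 ⟨w, hw⟩⟩
  · rintro ⟨w, hw⟩ ⟨h, hh⟩ hz
    have hz : w.2 + h = 0 := hz
    have hw2 : w.2 = -h := eq_neg_of_add_eq_zero_left hz
    obtain ⟨hW, hmean⟩ := mem_sobolevMeanZero.1 hw
    -- The gradient `w.2 = -h` is also solenoidal, hence zero. Then `w.1` is constant by
    -- connectedness, and its mean value makes it zero.
    have hsol : w.2 ∈ solenoidal Ω p q := by rw [hw2]; exact neg_mem hh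
    have hg0 : w.2 = 0 :=
      (Lp.eq_zero_iff_ae_eq_zero).2 (huniq _ _ hW (mem_solenoidal.1 hsol))
    have hg0' : (w.2 : Vec d → Vec d) =ᵐ[volume.restrict Ω] 0 := by
      rw [hg0]; exact Lp.coeFn_zero _ _ _
    obtain ⟨c, hcst⟩ := exists_const_ae_eq_of_forall_isTest hΩ hc.isPreconnected
      (hW.1.integrable hq) fun φ hφ i => by
        rw [hW.2.2 φ hφ i, neg_eq_zero]
        refine integral_eq_zero_of_ae (hg0'.mono fun x hx => ?_)
        simp [hx]
    rw [integral_congr_ae hcst, integral_const, smul_eq_mul, mul_eq_zero] at hmean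
    have hc0 : c = 0 := hmean.resolve_left (measureReal_restrict_ne_zero hΩ hc.nonempty)
    have hu0 : w.1 = 0 := by
      refine (Lp.eq_zero_iff_ae_eq_zero).2 (hcst.trans ?_)
      rw [hc0]; rfl
    have hh0 : h = 0 := by rw [hg0, zero_add] at hz; exact hz
    have hw0 : w = 0 := Prod.ext hu0 hg0
    exact ⟨Subtype.ext hw0, Subtype.ext hh0⟩
  · intro v
    obtain ⟨ϑ, g, h, hϑ, ⟨hh, hsol⟩, hv⟩ := hex v (Lp.memLp v)
    obtain ⟨w, hw, c, -, hw2⟩ := exists_mem_sobolevMeanZero (p := p) hΩ hc.nonempty hϑ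
    have hhs : hh.toLp ∈ solenoidal Ω p q := by
      rw [mem_solenoidal]
      intro χ gχ hχ
      rw [← hsol χ gχ hχ]
      exact integral_congr_ae (hh.coeFn_toLp.mono fun x hx => by simp only [hx])
    refine ⟨⟨w, hw⟩, ⟨hh.toLp, hhs⟩, ?_⟩
    change w.2 + hh.toLp = v
    refine Lp.ext ?_
    filter_upwards [Lp.coeFn_add w.2 hh.toLp, hw2, hh.coeFn_toLp, hv] with x h1 h2 h3 h4
    rw [h1, Pi.add_apply, h2, h3, h4, Pi.add_apply]

end Sobolev

/-! ### The weak formulation of the vector `q`-Laplacian -/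

section WeakSolution

variable {d : ℕ}

/-- The operator that puts a vector into the `i`-th row of a matrix. -/
def rowEmbedding (i : Fin d) : Vec d →L[ℝ] Mat d :=
  ((PiLp.continuousLinearEquiv 2 ℝ (fun _ : Fin d => Vec d)).symm :
      (Fin d → Vec d) →L[ℝ] Mat d) ∘L ContinuousLinearMap.single ℝ (fun _ : Fin d => Vec d) i

theorem rowEmbedding_apply (i k : Fin d) (v : Vec d) :
    rowEmbedding i v k = if k = i then v else 0 := by
  change (Pi.single i v : Fin d → Vec d) k = _
  by_cases h : k = i
  · subst h; simp
  · simp [h]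

theorem sum_rowEmbedding (v : Fin d → Vec d) (k : Fin d) :
    (∑ i, rowEmbedding i (v i)) k = v k := by
  rw [WithLp.ofLp_sum, Finset.sum_apply]
  simp [rowEmbedding_apply]

theorem MemW1Vec.memLp {Ω : Set (Vec d)} {q : ℝ≥0∞} {χ : Vec d → Vec d} {Dχ : Vec d → Mat d}
    (h : MemW1Vec Ω q χ Dχ) : MemLp χ q (volume.restrict Ω) :=
  MemLp.of_eval_piLp fun i => (h i).1

theorem MemW1Vec.memLp_jacobian {Ω : Set (Vec d)} {q : ℝ≥0∞} {χ : Vec d → Vec d}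
    {Dχ : Vec d → Mat d} (h : MemW1Vec Ω q χ Dχ) : MemLp Dχ q (volume.restrict Ω) :=
  MemLp.of_eval_piLp fun i => (h i).2.1

theorem integrable_mul_of_memLp {Ω : Set (Vec d)} {p q : ℝ≥0∞} [ENNReal.HolderConjugate p q]
    {a b : Vec d → ℝ} (ha : MemLp a p (volume.restrict Ω)) (hb : MemLp b q (volume.restrict Ω)) :
    Integrable (fun x => a x * b x) (volume.restrict Ω) :=
  ha.integrable_mul hb

theorem integral_mul_inner_eq_sum {Ω : Set (Vec d)} {a : Vec d → ℝ} {b : Vec d → Vec d} {χ : Vec d → Vec d}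
    (hab : ∀ i, Integrable (fun x => a x * b x i * χ x i) (volume.restrict Ω)) :
    ∫ x in Ω, a x * inner ℝ (b x) (χ x) = ∑ i, ∫ x in Ω, a x * b x i * χ x i := by
  rw [← integral_finsetSum _ fun i _ => hab i]
  congr 1
  ext x
  rw [PiLp.inner_apply, Finset.mul_sum]
  refine Finset.sum_congr rfl fun i _ => ?_
  simp only [RCLike.inner_apply, conj_trivial]
  ring

/-- The functional `F` is a sum over the components of the test field. -/
theorem constraintFunctional_eq_sum {Ω : Set (Vec d)} {p q : ℝ≥0∞} [ENNReal.HolderConjugate p q]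
    {f ju : Vec d → ℝ} {gy : Vec d → Vec d}
    (hfy : ∀ i, MemLp (fun x => f x * gy x i) p (volume.restrict Ω))
    (hju : MemLp ju p (volume.restrict Ω)) {χ : Vec d → Vec d} {Dχ : Vec d → Mat d}
    (hχ : MemW1Vec Ω q χ Dχ) :
    constraintFunctional Ω f gy ju χ Dχ
      = ∑ i, ((∫ x in Ω, f x * gy x i * χ x i) + ∫ x in Ω, ju x * Dχ x i i) := by
  rw [constraintFunctional, Finset.sum_add_distrib,
    integral_mul_inner_eq_sum fun i => integrable_mul_of_memLp (q := q) (hfy i) (hχ i).1]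
  congr 1
  rw [← integral_finsetSum _ fun i _ =>
    integrable_mul_of_memLp (q := q) hju (memLp_apply (hχ i).2.1 i)]
  congr 1
  ext x
  rw [Finset.mul_sum]

variable {Ω : Set (Vec d)} [IsFiniteMeasure (volume.restrict Ω)] {p q : ℝ≥0∞}
  [Fact (1 ≤ p)] [Fact (1 ≤ q)] [ENNReal.HolderConjugate p q]

variable (Ω p q) in
/-- The weak Jacobian on `d`-tuples of mean-zero Sobolev functions. -/
def jacobian : (Fin d → sobolevMeanZero Ω p q) →L[ℝ] Lp (Mat d) q (volume.restrict Ω) :=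
  ∑ i, (rowEmbedding i).compLpL q (volume.restrict Ω) ∘L
    ((ContinuousLinearMap.snd ℝ (Lp ℝ q (volume.restrict Ω)) (Lp (Vec d) q (volume.restrict Ω)) ∘L
      (sobolevMeanZero Ω p q).subtypeL) ∘L
        ContinuousLinearMap.proj (R := ℝ) (φ := fun _ : Fin d => sobolevMeanZero Ω p q) i)

theorem jacobian_ae (w : Fin d → sobolevMeanZero Ω p q) :
    ∀ᵐ x ∂(volume.restrict Ω), ∀ i, jacobian Ω p q w x i = (w i).1.2 x := by
  have h1 : jacobian Ω p q w
      = ∑ i, (rowEmbedding i).compLpL q (volume.restrict Ω) (w i).1.2 := by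
    rw [jacobian, sum_apply]
    rfl
  have h2 : ∀ᵐ x ∂(volume.restrict Ω), ∀ i : Fin d,
      (rowEmbedding i).compLpL q (volume.restrict Ω) (w i).1.2 x
        = rowEmbedding i ((w i).1.2 x) :=
    ae_all_iff.2 fun i => ContinuousLinearMap.coeFn_compLpL _ _
  have h3 := Lp.coeFn_finsetSum Finset.univ
    (fun i => (rowEmbedding i).compLpL q (volume.restrict Ω) (w i).1.2)
  rw [h1]
  filter_upwards [h2, h3] with x hx2 hx3 i
  rw [hx3, Finset.sum_apply]
  simp_rw [hx2]
  exact sum_rowEmbedding (fun i => (w i).1.2 x) i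

/-- The scalar Poincaré constant survives unchanged: tuples carry the supremum norm, and each row is
bounded by the Frobenius norm. -/
theorem norm_le_jacobian {C : ℝ} (hC0 : 0 ≤ C)
    (hC : ∀ w ∈ sobolevMeanZero Ω p q, ‖w‖ ≤ C * ‖w.2‖)
    (w : Fin d → sobolevMeanZero Ω p q) : ‖w‖ ≤ C * ‖jacobian Ω p q w‖ := by
  refine (pi_norm_le_iff_of_nonneg (by positivity)).2 fun i => (hC _ (w i).2).trans ?_
  refine mul_le_mul_of_nonneg_left (Lp.norm_le_norm_of_ae_le ?_) hC0
  filter_upwards [jacobian_ae w] with x hx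
  rw [← hx i]
  exact PiLp.norm_apply_le _ i

theorem exists_tuple_sobolevMeanZero (hΩ : IsOpen Ω) (hne : Ω.Nonempty) {χ : Vec d → Vec d}
    {Dχ : Vec d → Mat d} (h : MemW1Vec Ω q χ Dχ) :
    ∃ w : Fin d → sobolevMeanZero Ω p q, ∃ c : Vec d,
      (∀ᵐ x ∂(volume.restrict Ω), ∀ i, (w i).1.1 x = χ x i - c i) ∧
      (∀ᵐ x ∂(volume.restrict Ω), ∀ i, (w i).1.2 x = Dχ x i) := by
  choose w hw c h1 h2 using fun i => exists_mem_sobolevMeanZero (p := p) hΩ hne (h i)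
  exact ⟨fun i => ⟨w i, hw i⟩, WithLp.toLp 2 c, ae_all_iff.2 h1, ae_all_iff.2 h2⟩

/-- The Euler-Lagrange equation holds for mean-zero test fields, and `hcomp` extends it to all test
fields, since constants contribute neither to the Jacobian nor to `F`. -/
theorem exists_weakSolution {r s : ℝ} (hr : 2 ≤ s) (hrs : r.HolderConjugate s)
    (hΩ : IsOpen Ω) (hc : IsConnected Ω) (hH : HasHelmholtz Ω s r)
    {f ju : Vec d → ℝ} {gy : Vec d → Vec d} {K : Vec d → Mat d}
    (hfy : ∀ i, MemLp (fun x => f x * gy x i) (ENNReal.ofReal r) (volume.restrict Ω))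
    (hju : MemLp ju (ENNReal.ofReal r) (volume.restrict Ω))
    (hK : MemLp K (ENNReal.ofReal r) (volume.restrict Ω))
    (hcomp : ∀ i, ∫ x in Ω, f x * gy x i = 0) :
    ∃ θ Dθ, MemW1Vec Ω (ENNReal.ofReal s) θ Dθ ∧
      ∀ χ Dχ, MemW1Vec Ω (ENNReal.ofReal s) χ Dχ →
        (∫ x in Ω, inner ℝ (dualityMap s (Dθ x)) (Dχ x)) + (∫ x in Ω, inner ℝ (K x) (Dχ x))
          + constraintFunctional Ω f gy ju χ Dχ = 0 := by
  set P := ENNReal.ofReal r with hP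
  set Q := ENNReal.ofReal s with hQ
  have hP1 : 1 ≤ P := ENNReal.one_le_ofReal.2 hrs.lt.le
  have hQ1 : 1 ≤ Q := ENNReal.one_le_ofReal.2 hrs.symm.lt.le
  have : Fact (1 ≤ P) := ⟨hP1⟩
  have : Fact (1 ≤ Q) := ⟨hQ1⟩
  have : ENNReal.HolderConjugate P Q := hrs.ennrealOfReal
  obtain ⟨C, hC0, hC⟩ := exists_poincare (p := P) (q := Q) hΩ hc hH.1
    fun ϑ g hg hs => hH.2 ϑ g hg ⟨hg.2.1, hs⟩
  set L : (Fin d → sobolevMeanZero Ω P Q) →L[ℝ] ℝ :=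
    (∑ i, (lpInner (hfy i) Q ∘L ContinuousLinearMap.fst ℝ _ _ +
      lpInner (memLp_single hju i) Q ∘L ContinuousLinearMap.snd ℝ _ _) ∘L
        ((sobolevMeanZero Ω P Q).subtypeL ∘L
          ContinuousLinearMap.proj (R := ℝ) (φ := fun _ : Fin d => sobolevMeanZero Ω P Q) i)) +
      lpInner hK Q ∘L jacobian Ω P Q with hL
  have hLapp : ∀ w, L w = (∑ i, ((∫ x in Ω, f x * gy x i * (w i).1.1 x)
      + ∫ x in Ω, ju x * (w i).1.2 x i)) + ∫ x in Ω, inner ℝ (K x) (jacobian Ω P Q w x) := by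
    intro w
    have e : L w = (∑ i, (lpInner (hfy i) Q (w i).1.1
        + lpInner (memLp_single hju i) Q (w i).1.2)) + lpInner hK Q (jacobian Ω P Q w) := by
      rw [hL, add_apply, sum_apply]
      rfl
    rw [e]
    simp only [lpInner_apply, EuclideanSpace.inner_single_left, RCLike.inner_apply, conj_trivial]
    simp_rw [mul_comm (((w _).1.1 : Vec d → ℝ) _)]
  obtain ⟨w, hw⟩ := exists_eulerLagrange_rpow_add_linear hr hrs.symm (jacobian Ω P Q) L C
    (norm_le_jacobian hC0 hC)
  refine ⟨fun x => WithLp.toLp 2 fun i => (w i).1.1 x, jacobian Ω P Q w, fun i => ?_,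
    fun χ Dχ hχ => ?_⟩
  · refine (mem_sobolevMeanZero.1 (w i).2).1.congr (ae_eq_refl _) ?_
    filter_upwards [jacobian_ae w] with x hx
    rw [hx i]
  · obtain ⟨v, c, hv1, hv2⟩ := exists_tuple_sobolevMeanZero (p := P) hΩ hc.nonempty hχ
    have hjac : jacobian Ω P Q v =ᵐ[volume.restrict Ω] Dχ := by
      filter_upwards [jacobian_ae v, hv2] with x hx1 hx2
      ext i : 1
      rw [hx1 i, hx2 i]
    have h := hw v
    rw [hLapp] at h
    have e1 : ∫ x in Ω, inner ℝ (dualityMap s (jacobian Ω P Q w x)) (jacobian Ω P Q v x)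
        = ∫ x in Ω, inner ℝ (dualityMap s (jacobian Ω P Q w x)) (Dχ x) :=
      integral_congr_ae (hjac.mono fun x hx => by simp only [hx])
    have e2 : ∫ x in Ω, inner ℝ (K x) (jacobian Ω P Q v x) = ∫ x in Ω, inner ℝ (K x) (Dχ x) :=
      integral_congr_ae (hjac.mono fun x hx => by simp only [hx])
    have e3 : ∀ i, ∫ x in Ω, f x * gy x i * (v i).1.1 x = ∫ x in Ω, f x * gy x i * χ x i := by
      intro i
      have h1 : ∫ x in Ω, f x * gy x i * (v i).1.1 x
          = ∫ x in Ω, (f x * gy x i * χ x i - f x * gy x i * c i) :=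
        integral_congr_ae (hv1.mono fun x hx => by simp only [hx i, mul_sub])
      rw [h1, integral_sub (integrable_mul_of_memLp (q := Q) (hfy i) (hχ i).1)
        (((hfy i).integrable hP1).mul_const _), integral_mul_const, hcomp i, zero_mul, sub_zero]
    have e4 : ∀ i, ∫ x in Ω, ju x * (v i).1.2 x i = ∫ x in Ω, ju x * Dχ x i i := fun i =>
      integral_congr_ae (hv2.mono fun x hx => by simp only [hx i])
    rw [e1, e2] at h
    simp_rw [e3, e4] at h
    rw [constraintFunctional_eq_sum (q := Q) hfy hju hχ]
    linarith

end WeakSolution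

/-! ### The KKT system -/

section KKT

variable {d : ℕ} {Ω : Set (Vec d)}

theorem inner_rowEmbedding (A : Mat d) (i : Fin d) (v : Vec d) :
    inner ℝ A (rowEmbedding i v) = inner ℝ (A i) v := by
  rw [PiLp.inner_apply, Finset.sum_eq_single i]
  · rw [rowEmbedding_apply, if_pos rfl]
  · intro k _ hk
    rw [rowEmbedding_apply, if_neg hk, inner_zero_right]
  · simp

theorem rowEmbedding_inner (A : Mat d) (i : Fin d) (v : Vec d) :
    inner ℝ (rowEmbedding i v) A = inner ℝ v (A i) := by
  rw [real_inner_comm, inner_rowEmbedding, real_inner_comm]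

theorem IsTest.memW1Vec_single {φ : Vec d → ℝ} (hφ : IsTest Ω φ) (q : ℝ≥0∞) (i : Fin d) :
    MemW1Vec Ω q (fun x => EuclideanSpace.single i (φ x))
      (fun x => rowEmbedding i (gradient φ x)) := by
  intro k
  by_cases h : k = i
  · subst h
    simpa [rowEmbedding_apply] using hφ.memW1 q
  · simp only [rowEmbedding_apply, PiLp.single_apply, if_neg h]
    exact ⟨MemLp.zero, MemLp.zero, fun φ _ i => by simp⟩

/-- Vanishing of the normal trace includes the definition of the distributional divergence. -/
theorem memSigmaZero_of_normalTrace_eq_zero {p ps : ℝ} {T : Vec d → Mat d}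
    {divT : Vec d → Vec d} (hT : MemLp T (ENNReal.ofReal p) (volume.restrict Ω))
    (hdiv : MemLp divT (ENNReal.ofReal p) (volume.restrict Ω))
    (h : ∀ χ Dχ, MemW1Vec Ω (ENNReal.ofReal ps) χ Dχ → normalTrace Ω T divT χ Dχ = 0) :
    MemSigmaZero Ω p ps T divT := by
  refine ⟨⟨hT, hdiv, fun φ hφ i => ?_⟩, h⟩
  have := h _ _ (hφ.memW1Vec_single _ i)
  simp only [normalTrace, inner_rowEmbedding, EuclideanSpace.inner_single_right,
    conj_trivial] at this
  simp_rw [mul_comm (φ _)] at this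
  linarith

/-- The matrix field with the single non-zero entry `φ` belongs to `Σ^{p,0}`. -/
theorem IsTest.memSigmaZero_single {φ : Vec d → ℝ} (hφ : IsTest Ω φ) (p ps : ℝ) (i k : Fin d) :
    MemSigmaZero Ω p ps (fun x => rowEmbedding i (EuclideanSpace.single k (φ x)))
      (fun x => EuclideanSpace.single i (gradient φ x k)) := by
  refine memSigmaZero_of_normalTrace_eq_zero
    ((rowEmbedding i).comp_memLp' (memLp_single (hφ.memLp _) k))
    (memLp_single (hφ.memLp_gradient_apply _ k) i) fun χ Dχ hχ => ?_
  have := (hχ i).2.2 φ hφ k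
  simp_rw [normalTrace, rowEmbedding_inner, EuclideanSpace.inner_single_left, conj_trivial]
  simp_rw [mul_comm (φ _), mul_comm (gradient φ _ k)]
  linarith

theorem IsAdmissible.integral_inner_sub_eq_zero {p ps : ℝ} (hps : p.HolderConjugate ps)
    {f ju : Vec d → ℝ} {gy : Vec d → Vec d} {S T : Vec d → Mat d}
    (hS : IsAdmissible Ω p ps f gy ju S) (hT : IsAdmissible Ω p ps f gy ju T)
    {χ : Vec d → Vec d} {Dχ : Vec d → Mat d} (hχ : MemW1Vec Ω (ENNReal.ofReal ps) χ Dχ) :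
    ∫ x in Ω, inner ℝ (Dχ x) (T x - S x) = 0 := by
  have h1 := hS.2 χ Dχ hχ
  have h2 := hT.2 χ Dχ hχ
  rw [← h1, weakDiv, weakDiv, neg_inj] at h2
  simp_rw [real_inner_comm (_ - _), inner_sub_left]
  rw [integral_sub (integrable_inner_of_holderConjugate hps hT.1 hχ.memLp_jacobian)
    (integrable_inner_of_holderConjugate hps hS.1 hχ.memLp_jacobian), h2, sub_self]

theorem IsAdmissible.congr {p ps : ℝ} {f ju : Vec d → ℝ} {gy : Vec d → Vec d}
    {S T : Vec d → Mat d} (hS : IsAdmissible Ω p ps f gy ju S)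
    (h : S =ᵐ[volume.restrict Ω] T) : IsAdmissible Ω p ps f gy ju T := by
  refine ⟨hS.1.ae_eq h, fun χ Dχ hχ => ?_⟩
  rw [← hS.2 χ Dχ hχ, weakDiv, weakDiv, neg_inj]
  exact integral_congr_ae (h.mono fun x hx => by simp only [hx])

/-- The KKT system says that `|S - K|^{p-2} (S - K)` is the weak Jacobian of the multiplier. -/
theorem isKKT_iff {p ps : ℝ} (hps : p.HolderConjugate ps) {f ju : Vec d → ℝ}
    {gy : Vec d → Vec d} {K S : Vec d → Mat d} {θ : Vec d → Vec d}
    (hK : MemLp K (ENNReal.ofReal p) (volume.restrict Ω)) :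
    IsKKT Ω p ps f gy ju K S θ ↔ IsAdmissible Ω p ps f gy ju S ∧
      MemW1Vec Ω (ENNReal.ofReal ps) θ (fun x => dualityMap p (S x - K x)) := by
  constructor
  · rintro ⟨hS, ⟨Dθ, hθ⟩, h⟩
    have hE := memLp_dualityMap hps (hS.1.sub hK)
    refine ⟨hS, fun i => ⟨(hθ i).1, hE.eval_piLp i, fun φ hφ k => ?_⟩⟩
    -- For this field the KKT equation is the definition of the `k`-th weak derivative of the `i`-th
    -- component of `θ`.
    have := h _ _ (hφ.memSigmaZero_single p ps i k)
    change (∫ x in Ω, inner ℝ (dualityMap p (S x - K x)) _) + _ = 0 at this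
    simp only [inner_rowEmbedding, EuclideanSpace.inner_single_right,
      EuclideanSpace.inner_single_left, conj_trivial] at this
    simp_rw [mul_comm (φ _), mul_comm (gradient φ _ k)] at this
    linarith
  · rintro ⟨hS, hθ⟩
    refine ⟨hS, ⟨_, hθ⟩, fun T divT hT => ?_⟩
    have := hT.2 _ _ hθ
    simp_rw [normalTrace, real_inner_comm (dualityMap _ _)] at this
    exact this

/-- The first component of a solution of the KKT system is closest to `K`. -/
theorem IsKKT.eLpNorm_le {p ps : ℝ} (hps : p.HolderConjugate ps) {f ju : Vec d → ℝ}
    {gy : Vec d → Vec d} {K S T : Vec d → Mat d} {θ : Vec d → Vec d}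
    (hK : MemLp K (ENNReal.ofReal p) (volume.restrict Ω))
    (h : IsKKT Ω p ps f gy ju K S θ) (hT : IsAdmissible Ω p ps f gy ju T) :
    eLpNorm (fun x => S x - K x) (ENNReal.ofReal p) (volume.restrict Ω)
        ≤ eLpNorm (fun x => T x - K x) (ENNReal.ofReal p) (volume.restrict Ω) ∧
      (eLpNorm (fun x => T x - K x) (ENNReal.ofReal p) (volume.restrict Ω)
        ≤ eLpNorm (fun x => S x - K x) (ENNReal.ofReal p) (volume.restrict Ω) →
          T =ᵐ[volume.restrict Ω] S) := by
  obtain ⟨hS, hθ⟩ := (isKKT_iff hps hK).1 h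
  have h0 := hS.integral_inner_sub_eq_zero hps hT hθ
  obtain ⟨h1, h2⟩ := integral_norm_rpow_le_of_inner_eq_zero hps (hS.1.sub hK) (hT.1.sub hK)
    (by simpa using h0)
  refine ⟨h1, fun hle => (h2 hle).mono fun x hx => ?_⟩
  simpa using hx

theorem IsKKT.isMinimizer {p ps : ℝ} (hps : p.HolderConjugate ps) {f ju : Vec d → ℝ}
    {gy : Vec d → Vec d} {K S : Vec d → Mat d} {θ : Vec d → Vec d}
    (hK : MemLp K (ENNReal.ofReal p) (volume.restrict Ω))
    (h : IsKKT Ω p ps f gy ju K S θ) : IsMinimizer Ω p ps f gy ju K S := by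
  refine ⟨h.1, le_antisymm (le_sInf ?_) (sInf_le ⟨S, h.1, rfl⟩)⟩
  rintro _ ⟨T, hT, rfl⟩
  exact (h.eLpNorm_le hps hK hT).1

theorem IsKKT.ae_eq_of_isMinimizer {p ps : ℝ} (hps : p.HolderConjugate ps) {f ju : Vec d → ℝ}
    {gy : Vec d → Vec d} {K S T : Vec d → Mat d} {θ : Vec d → Vec d}
    (hK : MemLp K (ENNReal.ofReal p) (volume.restrict Ω))
    (h : IsKKT Ω p ps f gy ju K S θ) (hT : IsMinimizer Ω p ps f gy ju K T) :
    T =ᵐ[volume.restrict Ω] S :=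
  (h.eLpNorm_le hps hK hT.1).2 (hT.2.trans (h.isMinimizer hps hK).2.symm).le

theorem MemW1Vec.congr {q : ℝ≥0∞} {θ θ' : Vec d → Vec d} {Dθ Dθ' : Vec d → Mat d}
    (h : MemW1Vec Ω q θ Dθ) (h1 : θ =ᵐ[volume.restrict Ω] θ')
    (h2 : Dθ =ᵐ[volume.restrict Ω] Dθ') : MemW1Vec Ω q θ' Dθ' := fun i =>
  (h i).congr (h1.mono fun x hx => by simp only [hx]) (h2.mono fun x hx => by simp only [hx])

variable [IsFiniteMeasure (volume.restrict Ω)]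

/-- The `p*`-Laplace equation for `θ` is admissibility of `S = K + |∇θ|^{p*-2} ∇θ`, and inverting
the duality map gives the other KKT equation. -/
theorem exists_isKKT {p ps : ℝ} (hps2 : 2 ≤ ps) (hps : p.HolderConjugate ps)
    (hΩ : IsOpen Ω) (hc : IsConnected Ω) (hH : HasHelmholtz Ω ps p)
    {f ju : Vec d → ℝ} {gy : Vec d → Vec d} {K : Vec d → Mat d}
    (hfy : ∀ i, MemLp (fun x => f x * gy x i) (ENNReal.ofReal p) (volume.restrict Ω))
    (hju : MemLp ju (ENNReal.ofReal p) (volume.restrict Ω))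
    (hK : MemLp K (ENNReal.ofReal p) (volume.restrict Ω))
    (hcomp : ∀ i, ∫ x in Ω, f x * gy x i = 0) :
    ∃ S θ, IsKKT Ω p ps f gy ju K S θ := by
  obtain ⟨θ, Dθ, hθ, h⟩ := exists_weakSolution hps2 hps hΩ hc hH hfy hju hK hcomp
  have hR := memLp_dualityMap hps.symm hθ.memLp_jacobian
  refine ⟨fun x => K x + dualityMap ps (Dθ x), θ, (isKKT_iff hps hK).2
    ⟨⟨hK.add hR, fun χ Dχ hχ => ?_⟩, ?_⟩⟩
  · have := h χ Dχ hχ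
    simp_rw [weakDiv, inner_add_left]
    rw [integral_add (integrable_inner_of_holderConjugate hps hK hχ.memLp_jacobian)
      (integrable_inner_of_holderConjugate hps hR hχ.memLp_jacobian)]
    linarith
  · simp_rw [add_sub_cancel_left, dualityMap_dualityMap hps.symm]
    exact hθ

theorem MemW1Vec.ae_eq_add_const {q : ℝ≥0∞} (hq : 1 ≤ q) (hΩ : IsOpen Ω)
    (hc : IsPreconnected Ω) {θ θ' : Vec d → Vec d} {Dθ : Vec d → Mat d}
    (h : MemW1Vec Ω q θ Dθ) (h' : MemW1Vec Ω q θ' Dθ) :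
    ∃ e : Vec d, θ' =ᵐ[volume.restrict Ω] fun x => θ x + e := by
  have hi : ∀ i, ∃ c : ℝ, (fun x => θ' x i - θ x i) =ᵐ[volume.restrict Ω] fun _ => c := by
    intro i
    have hs := (h' i).sub hq (h i)
    refine exists_const_ae_eq_of_forall_isTest hΩ hc (hs.1.integrable hq) fun φ hφ k => ?_
    rw [hs.2.2 φ hφ k]
    simp
  choose c hcc using hi
  refine ⟨WithLp.toLp 2 c, (ae_all_iff.2 hcc).mono fun x hx => ?_⟩
  ext i
  have := hx i
  simp only [PiLp.add_apply]
  linarith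

theorem MemW1Vec.add_const {q : ℝ≥0∞} (hq : 1 ≤ q) {θ : Vec d → Vec d} {Dθ : Vec d → Mat d}
    (h : MemW1Vec Ω q θ Dθ) (e : Vec d) : MemW1Vec Ω q (fun x => θ x + e) Dθ := fun i =>
  ((h i).sub hq (memW1_const q (-(e i)))).congr (ae_of_all _ fun x => by simp)
    (ae_of_all _ fun x => by simp)

/-- The solutions of the KKT system are determined up to constants in the multiplier. -/
theorem IsKKT.isKKT_iff_ae_eq {p ps : ℝ} (hps : p.HolderConjugate ps) (hΩ : IsOpen Ω)
    (hc : IsPreconnected Ω) {f ju : Vec d → ℝ} {gy : Vec d → Vec d} {K S S' : Vec d → Mat d}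
    {θ θ' : Vec d → Vec d} (hK : MemLp K (ENNReal.ofReal p) (volume.restrict Ω))
    (h : IsKKT Ω p ps f gy ju K S θ) :
    IsKKT Ω p ps f gy ju K S' θ' ↔ S' =ᵐ[volume.restrict Ω] S ∧
      ∃ e : Vec d, θ' =ᵐ[volume.restrict Ω] fun x => θ x + e := by
  have hq : 1 ≤ ENNReal.ofReal ps := ENNReal.one_le_ofReal.2 hps.symm.lt.le
  obtain ⟨hS, hθ⟩ := (isKKT_iff hps hK).1 h
  constructor
  · intro h'
    have hSS := h.ae_eq_of_isMinimizer hps hK (h'.isMinimizer hps hK)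
    have hθ' := ((isKKT_iff hps hK).1 h').2.congr (ae_eq_refl _)
      (Dθ' := fun x => dualityMap p (S x - K x)) (hSS.mono fun x hx => by simp only [hx])
    exact ⟨hSS, hθ.ae_eq_add_const hq hΩ hc hθ'⟩
  · rintro ⟨hSS, e, he⟩
    exact (isKKT_iff hps hK).2 ⟨hS.congr hSS.symm, (hθ.add_const hq e).congr he.symm
      (hSS.mono fun x hx => by simp only [hx])⟩

end KKT

/-! ### Green's formula for functions with zero boundary values -/

section Green

variable {d : ℕ} {Ω : Set (Vec d)}

theorem abs_integral_mul_le {p q : ℝ≥0∞} [Fact (1 ≤ p)] [Fact (1 ≤ q)]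
    [ENNReal.HolderConjugate q p] {b : Vec d → ℝ} (hb : MemLp b q (volume.restrict Ω)) :
    ∃ C : ℝ, 0 ≤ C ∧ ∀ a : Vec d → ℝ, MemLp a p (volume.restrict Ω) → ∀ ε : ℝ, 0 ≤ ε →
      eLpNorm a p (volume.restrict Ω) ≤ ENNReal.ofReal ε →
        |∫ x in Ω, a x * b x| ≤ C * ε := by
  refine ⟨‖lpInner hb p‖, norm_nonneg _, fun a ha ε hε hle => ?_⟩
  have h1 : lpInner hb p ha.toLp = ∫ x in Ω, a x * b x := by
    rw [lpInner_apply]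
    refine integral_congr_ae (ha.coeFn_toLp.mono fun x hx => ?_)
    simp [hx]
  have h2 : ‖ha.toLp‖ ≤ ε := by
    rw [Lp.norm_toLp]
    exact ENNReal.toReal_le_of_le_ofReal hε hle
  rw [← h1, ← Real.norm_eq_abs]
  exact ((lpInner hb p).le_opNorm _).trans (mul_le_mul_of_nonneg_left h2 (norm_nonneg _))

/-- For a test function in place of `u` this is the definition of the weak gradient of `χ`. Both
sides are continuous in `u` with respect to the Sobolev norm, so density of test functions suffices.
-/
theorem MemW10.integral_mul_gradient {p q : ℝ≥0∞} [Fact (1 ≤ p)] [Fact (1 ≤ q)]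
    [ENNReal.HolderConjugate q p] {u χ : Vec d → ℝ} {g k : Vec d → Vec d}
    (hu : MemW10 Ω p u g) (hχ : MemW1 Ω q χ k) (i : Fin d) :
    ∫ x in Ω, u x * k x i = - ∫ x in Ω, g x i * χ x := by
  have hki := memLp_apply hχ.2.1 i
  have hgi := memLp_apply hu.1.2.1 i
  have : ENNReal.HolderConjugate p q := ENNReal.HolderConjugate.symm
  obtain ⟨C₁, hC₁, h₁⟩ := abs_integral_mul_le (p := p) hki
  obtain ⟨C₂, hC₂, h₂⟩ := abs_integral_mul_le (p := p) hχ.1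
  set I := (∫ x in Ω, u x * k x i) + ∫ x in Ω, g x i * χ x with hI
  have key : ∀ ε : ℝ, 0 < ε → |I| ≤ (C₁ + C₂) * ε := by
    intro ε hε
    obtain ⟨φ, hφ, hφ1, hφ2⟩ := hu.2 ε hε
    have hφi := hφ.memLp_gradient_apply p i
    have b1 := h₁ _ (hu.1.1.sub (hφ.memLp p)) ε hε.le hφ1
    have b2 := h₂ _ (hgi.sub hφi) ε hε.le (le_trans (eLpNorm_mono fun x => by
      simpa using PiLp.norm_apply_le (g x - gradient φ x) i) hφ2)
    have e0 := hχ.2.2 φ hφ i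
    have e1 : ∫ x in Ω, (u x - φ x) * k x i
        = (∫ x in Ω, u x * k x i) - ∫ x in Ω, k x i * φ x := by
      rw [← integral_sub (integrable_mul_of_memLp hu.1.1 hki)
        (integrable_mul_of_memLp hki (hφ.memLp p))]
      congr 1; ext x; ring
    have e2 : ∫ x in Ω, (g x i - gradient φ x i) * χ x
        = (∫ x in Ω, g x i * χ x) - ∫ x in Ω, χ x * gradient φ x i := by
      rw [← integral_sub (integrable_mul_of_memLp hgi hχ.1)
        (integrable_mul_of_memLp hχ.1 hφi)]
      congr 1; ext x; ring
    have e3 : I = (∫ x in Ω, (u x - φ x) * k x i)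
        + ∫ x in Ω, (g x i - gradient φ x i) * χ x := by
      rw [e1, e2, e0, hI]; ring
    rw [e3, add_mul]
    exact (abs_add_le _ _).trans (add_le_add b1 b2)
  have hI0 : |I| ≤ 0 := by
    refine le_of_forall_pos_le_add fun δ hδ => (key (δ / (C₁ + C₂ + 1)) (by positivity)).trans ?_
    rw [zero_add, mul_div_assoc', div_le_iff₀ (by positivity)]
    nlinarith
  have := abs_nonpos_iff.1 hI0
  linarith

/-- If `j(u) ∈ W_0^{1,p}(Ω)`, then admissible fields have their divergence in `L^p(Ω)`. -/
theorem isAdmissible_iff_isStrictlyAdmissible {p ps : ℝ} (hps : p.HolderConjugate ps)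
    {f ju : Vec d → ℝ} {gy gj : Vec d → Vec d} {T : Vec d → Mat d}
    (hfy : ∀ i, MemLp (fun x => f x * gy x i) (ENNReal.ofReal p) (volume.restrict Ω))
    (hj : MemW10 Ω (ENNReal.ofReal p) ju gj) :
    IsAdmissible Ω p ps f gy ju T ↔ IsStrictlyAdmissible Ω p ps f gy ju T := by
  have : Fact (1 ≤ ENNReal.ofReal p) := ⟨ENNReal.one_le_ofReal.2 hps.lt.le⟩
  have : Fact (1 ≤ ENNReal.ofReal ps) := ⟨ENNReal.one_le_ofReal.2 hps.symm.lt.le⟩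
  have := hps.ennrealOfReal
  have := hps.symm.ennrealOfReal
  constructor
  · rintro ⟨hT, hadm⟩
    -- This density of `F` appears once the divergence in the term with `j(u)` is moved onto `j(u)`
    -- without a boundary term.
    set divT : Vec d → Vec d := fun x => f x • gy x - gj x with hdivT
    have hfy' : MemLp (fun x => f x • gy x) (ENNReal.ofReal p) (volume.restrict Ω) :=
      MemLp.of_eval_piLp hfy
    have hdiv : MemLp divT (ENNReal.ofReal p) (volume.restrict Ω) := hfy'.sub hj.1.2.1
    have hF : ∀ χ Dχ, MemW1Vec Ω (ENNReal.ofReal ps) χ Dχ →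
        ∫ x in Ω, inner ℝ (divT x) (χ x) = constraintFunctional Ω f gy ju χ Dχ := by
      intro χ Dχ hχ
      have i1 : ∀ i, Integrable (fun x => ju x * Dχ x i i) (volume.restrict Ω) := fun i =>
        integrable_mul_of_memLp hj.1.1 (memLp_apply (hχ i).2.1 i)
      have i2 : ∀ i, Integrable (fun x => gj x i * χ x i) (volume.restrict Ω) := fun i =>
        integrable_mul_of_memLp (memLp_apply hj.1.2.1 i) (hχ i).1
      have e1 : ∫ x in Ω, ju x * ∑ i, Dχ x i i = - ∫ x in Ω, inner ℝ (gj x) (χ x) := by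
        simp_rw [Finset.mul_sum, PiLp.inner_apply, RCLike.inner_apply, conj_trivial]
        simp_rw [mul_comm (χ _ _)]
        rw [integral_finsetSum _ fun i _ => i1 i, integral_finsetSum _ fun i _ => i2 i,
          ← Finset.sum_neg_distrib]
        exact Finset.sum_congr rfl fun i _ => hj.integral_mul_gradient (hχ i) i
      rw [constraintFunctional, e1, ← sub_eq_add_neg, ← integral_sub]
      · simp_rw [hdivT, inner_sub_left, real_inner_smul_left]
      · simpa only [real_inner_smul_left] using
          integrable_inner_of_holderConjugate hps hfy' hχ.memLp
      · exact integrable_inner_of_holderConjugate hps hj.1.2.1 hχ.memLp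
    refine ⟨divT, memSigmaZero_of_normalTrace_eq_zero hT hdiv fun χ Dχ hχ => ?_, hF⟩
    have h1 := hadm χ Dχ hχ
    rw [weakDiv, ← hF χ Dχ hχ] at h1
    rw [normalTrace, ← h1]
    ring
  · rintro ⟨divT, hσ, hF⟩
    exact ⟨hσ.1.1, fun χ Dχ hχ => (hσ.weakDiv_eq hχ).trans (hF χ Dχ hχ)⟩

end Green

end ShapeLp

end

/-! ### The KKT system on a bounded domain -/

theorem theorem3p2 {d : ℕ} (hd : d = 2 ∨ d = 3)
    (Ω : Set (ShapeLp.Vec d)) (hΩo : IsOpen Ω) (hΩc : IsConnected Ω)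
    (hΩb : Bornology.IsBounded Ω)
    (p ps : ℝ) (hp1 : 1 < p) (hp2 : p ≤ 2) (hps : p.HolderConjugate ps)
    (hHelm : ShapeLp.HasHelmholtz Ω ps p)
    (f : ShapeLp.Vec d → ℝ) (hf : MemLp f ∞ (volume.restrict Ω))
    (j dj : (ShapeLp.Vec d → ℝ) → (ShapeLp.Vec d → ℝ))
    (hj : ShapeLp.IsDiffIntegrand Ω j dj)
    (u y : ShapeLp.Vec d → ℝ) (gu gy : ShapeLp.Vec d → ShapeLp.Vec d)
    (hu : ShapeLp.IsDirichletSolution Ω f u gu)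
    (hy : ShapeLp.IsDirichletSolution Ω (fun x => - dj u x) y gy)
    (hK : MemLp (ShapeLp.shapeTensor gu gy) (ENNReal.ofReal p) (volume.restrict Ω))
    (hju : MemLp (j u) 2 (volume.restrict Ω))
    (hcomp : ∀ e : ShapeLp.Vec d, ∫ x in Ω, f x * inner ℝ (gy x) e = 0) :
    (∃ (S : ShapeLp.Vec d → ShapeLp.Mat d) (θ : ShapeLp.Vec d → ShapeLp.Vec d),
      ShapeLp.IsKKT Ω p ps f gy (j u) (ShapeLp.shapeTensor gu gy) S θ ∧
      ShapeLp.IsMinimizer Ω p ps f gy (j u) (ShapeLp.shapeTensor gu gy) S ∧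
      (∀ S', ShapeLp.IsMinimizer Ω p ps f gy (j u) (ShapeLp.shapeTensor gu gy) S' →
        S' =ᵐ[volume.restrict Ω] S) ∧
      (∀ S' θ', ShapeLp.IsKKT Ω p ps f gy (j u) (ShapeLp.shapeTensor gu gy) S' θ' ↔
        S' =ᵐ[volume.restrict Ω] S ∧
          ∃ e : ShapeLp.Vec d, θ' =ᵐ[volume.restrict Ω] fun x => θ x + e)) ∧
    (∀ gj, ShapeLp.MemW10 Ω (ENNReal.ofReal p) (j u) gj →
      ∀ T, ShapeLp.IsAdmissible Ω p ps f gy (j u) T ↔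
        ShapeLp.IsStrictlyAdmissible Ω p ps f gy (j u) T) := by
  have : IsFiniteMeasure (volume.restrict Ω) :=
    ⟨by rw [Measure.restrict_apply_univ]; exact hΩb.measure_lt_top⟩
  -- The bound `p ≤ 2` enters twice: here, for Clarkson's inequality with exponent `p*`, and next,
  -- since on the bounded set `Ω` it places the `L^2` functions `f ∂_i y` and `j(u)` in `L^p`.
  have hps2 : 2 ≤ ps := by
    have h1 := hps.sub_one_mul_conj
    have h2 := hps.symm.pos
    nlinarith
  have hle : ENNReal.ofReal p ≤ 2 := by
    rw [show (2 : ℝ≥0∞) = ENNReal.ofReal 2 by simp]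
    exact ENNReal.ofReal_le_ofReal hp2
  have hfy : ∀ i, MemLp (fun x => f x * gy x i) (ENNReal.ofReal p) (volume.restrict Ω) :=
    fun i => ((ShapeLp.memLp_apply hy.1.1.2.1 i).mul hf).mono_exponent hle
  obtain ⟨S, θ, h⟩ := ShapeLp.exists_isKKT hps2 hps hΩo hΩc hHelm hfy
    (hju.mono_exponent hle) hK fun i => by
      simpa [EuclideanSpace.inner_single_right] using hcomp (EuclideanSpace.single i (1 : ℝ))
  exact ⟨⟨S, θ, h, h.isMinimizer hps hK, fun S' => h.ae_eq_of_isMinimizer hps hK,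
    fun S' θ' => h.isKKT_iff_ae_eq hps hΩo hΩc.isPreconnected hK⟩,
    fun gj hgj T => ShapeLp.isAdmissible_iff_isStrictlyAdmissible hps hfy hgj⟩
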